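/- All logarithms are natural. Let $n\ge 1$, $d\ge 0$, $r\ge 1$, and let $X$ be an arbitrary random vector in $\mathbb R^n$ (not necessarily log-concave, centered, or having a density). For $p>0$ put $\|X\|_p=\big(\mathbb E\sum_{i=1}^n|X_i|^p\big)^{1/p}\in[0,\infty]$. Let $$\mathbb R_X(d)=\inf\Big\{ I(X;\hat X)\;:\; P_{\hat X|X},\ \tfrac1n\|X-\hat X\|_r^r\le d\Big\},$$ the infimum being over all transition probability kernels $\mathbb R^n\to\mathbb R^n$, and, for $d>0$, let $$\underline{\mathbb R}_X(d)=h(X)-n\log\big(\alpha_r d^{1/r}\big),\qquad \alpha_r=2e^{1/r}\,\Gamma\!\left(1+\tfrac1r\right) r^{1/r},\qquad \beta_r=\sqrt{1+\frac{r^{2/r}\,\Gamma(3/r)}{\Gamma(1/r)}},$$ where $h(X)\in[-\infty,\infty)$ is the differential entropy ($h(X)=-\infty$ if $X$ has no density). When $\|X\|_2<\infty$, let $K_X$ be the covariance matrix of $X$, $|K_X|$ its determinant, and $G_X\sim\mathcal N(m,K_X)$ a Gaussian vector with the same covariance matrix as $X$ and any mean $m\in\mathbb R^n$ (for instance $m=0$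 or $m=\mathbb E[X]$). $D(\cdot\|\cdot)$ is relative entropy. Both sides of the inequalities below are extended real numbers; the last term in (1) and (2) is $+\infty$ if $|K_X|=0$. 1) Let $r\in[1,2]$. If $d>0$ and $\sqrt n\,d^{1/r}<\|X\|_2<\infty$, then $$\mathbb R_X(d)-\underline{\mathbb R}_X(d)\le D(X\|G_X)+n\log\frac{\alpha_r}{\sqrt{2\pi e}}+\frac n2\log\frac{\frac1n\|X\|_2^2}{|K_X|^{1/n}}.\tag{1}$$ If $\|X\|_2\le\sqrt n\,d^{1/r}$, then $\mathbb R_X(d)=0$. 2) Let $r>2$. If $d>0$ and $\sqrt n\,d^{1/r}\le\|X\|_2<\infty$, then $$\mathbb R_X(d)-\underline{\mathbb R}_X(d)\le D(X\|G_X)+n\log\beta_r+\frac n2\log\frac{\frac1n\|X\|_2^2}{|K_X|^{1/n}}.\tag{2}$$ If $\|X\|_r\le(nd)^{1/r}$, then $\mathbb R_X(d)=0$. If $\|X\|_r>(nd)^{1/r}$ and $\|X\|_2<\sqrt n\,d^{1/r}$, then $$\mathbb R_X(d)\le n\log\frac{\sqrt{2\pi e}\,\beta_r}{\alpha_r}.$$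 -/

import Mathlib

open MeasureTheory ProbabilityTheory InformationTheory
open scoped ENNReal

namespace RateDistortion

/-- The constant `α_p = 2 e^{1/p} Γ(1 + 1/p) p^{1/p}`. -/
noncomputable def alphaConst (p : ℝ) : ℝ :=
  2 * Real.exp (1 / p) * Real.Gamma (1 + 1 / p) * p ^ (1 / p)

/-- The constant `β_r = √(1 + r^{2/r} Γ(3/r) / Γ(1/r))`. -/
noncomputable def betaConst (r : ℝ) : ℝ :=
  √(1 + r ^ (2 / r) * Real.Gamma (3 / r) / Real.Gamma (1 / r))

variable {n : ℕ}

/-- The `p`-norm `‖X‖_p = (E ∑ |X_i|^p)^{1/p}` of a random vector with law `μ`, possibly `∞`. -/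
noncomputable def momentNorm (p : ℝ) (μ : Measure (EuclideanSpace ℝ (Fin n))) : ℝ≥0∞ :=
  (∫⁻ x, ∑ i, ENNReal.ofReal (|x i| ^ p) ∂μ) ^ (1 / p)

/-- The covariance matrix `K_X` of a random vector with law `μ`. -/
noncomputable def covMatrix (μ : Measure (EuclideanSpace ℝ (Fin n))) :
    Matrix (Fin n) (Fin n) ℝ :=
  Matrix.of fun i j => covariance (fun x => x i) (fun x => x j) μ

/-- The distortion `(1/n) E ∑ |X_i - X̂_i|^r` when `X` has law `μ` and `X̂` is obtained from `X`
through the transition kernel `κ`. -/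
noncomputable def distortion (r : ℝ) (μ : Measure (EuclideanSpace ℝ (Fin n)))
    (κ : Kernel (EuclideanSpace ℝ (Fin n)) (EuclideanSpace ℝ (Fin n))) : ℝ≥0∞ :=
  (∫⁻ x, ∫⁻ y, ∑ i, ENNReal.ofReal (|x i - y i| ^ r) ∂(κ x) ∂μ) / n

/-- The mutual information `I(X; X̂) = D(P_{X X̂} ‖ P_X ⊗ P_X̂)` (in nats) when `X` has law `μ` and
`X̂` is obtained from `X` through the transition kernel `κ`. -/
noncomputable def mutualInfo (μ : Measure (EuclideanSpace ℝ (Fin n)))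
    (κ : Kernel (EuclideanSpace ℝ (Fin n)) (EuclideanSpace ℝ (Fin n))) : ℝ≥0∞ :=
  klDiv (μ.compProd κ) (μ.prod (μ.bind κ))

/-- The rate-distortion function under the `r`-th moment distortion measure: the infimum of
`I(X; X̂)` over all transition probability kernels of distortion at most `d`. -/
noncomputable def rateDistortion (r : ℝ) (μ : Measure (EuclideanSpace ℝ (Fin n))) (d : ℝ) :
    ℝ≥0∞ :=
  ⨅ (κ : Kernel (EuclideanSpace ℝ (Fin n)) (EuclideanSpace ℝ (Fin n))) (_ : IsMarkovKernel κ)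
    (_ : distortion r μ κ ≤ ENNReal.ofReal d), mutualInfo μ κ

open Classical in
/-- The differential entropy `h = - ∫ f log f` (in nats) of a law `μ` with density `f`, as an
extended real number: the integral of the positive part of `- f log f` minus the integral of its
negative part. The former is finite for every law with finite second moment. A law without density
has differential entropy `-∞`. -/
noncomputable def diffEntropy (μ : Measure (EuclideanSpace ℝ (Fin n))) : EReal :=
  if μ ≪ volume then
    ((∫⁻ x, ENNReal.ofReal (Real.negMulLog (μ.rnDeriv volume x).toReal) : ℝ≥0∞) : EReal) -
      ((∫⁻ x, ENNReal.ofReal (-Real.negMulLog (μ.rnDeriv volume x).toReal) : ℝ≥0∞) : EReal)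
  else ⊥

/-- The Shannon lower bound `h(X) - n log (α_r d^{1/r})`, for `d > 0`. -/
noncomputable def shannonLowerBound (r : ℝ) (μ : Measure (EuclideanSpace ℝ (Fin n))) (d : ℝ) :
    EReal :=
  diffEntropy μ - ((n * Real.log (alphaConst r * d ^ (1 / r)) : ℝ) : EReal)

/-- The term `(n/2) log ((1/n) ‖X‖₂² / |K_X|^{1/n})`, with value `+∞` if `|K_X| = 0 < ‖X‖₂`. -/
noncomputable def normCovTerm (μ : Measure (EuclideanSpace ℝ (Fin n))) : EReal :=
  ((n / 2 : ℝ) : EReal) *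
    ENNReal.log (momentNorm 2 μ ^ 2 / n / ENNReal.ofReal ((covMatrix μ).det ^ (1 / (n : ℝ))))

end RateDistortion

/-! Every bound on the rate comes from one explicit channel `x ↦ a x + Z`, with i.i.d. centred noise
independent of `X`. Replacing the output law in the mutual information by any law `Q` only increases
the divergence (`klDiv_compProd_prod_bind_le`). Taking `Q` to be the centred Gaussian with i.i.d.
coordinates of variance `τ`, where `n τ` is the second moment of the output, gives `I ≤ n ((1/2) log
(2πe τ) - h(Z₁))` (`mutualInfo_noiseChannel_le`). Only second moments of `X` enter, so neither a
density nor a zero mean is needed.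

Write `T = ‖X‖₂²/n` and `D = d^{2/r}`. For `r ≤ 2` and `T > D`, Gaussian noise of variance `a D`
with `a = 1 - D/T` has mean square error `D`, hence `r`-distortion at most `d`, and the bound is
`(n/2) log (T/D)`. For `r > 2`, take `a = 1` and noise with density proportional to `exp (-|z|^r/(r
d))`. Its `r`-th moment is `d`, its entropy is `log (α_r d^{1/r})` and its variance is `D (β_r² -
1)`, so `τ ≤ β_r² max(T, D)`. When `X` is already small, the constant reproduction `0` has
admissible distortion and zero rate.

It remains to trade `h(X)` for the divergence: `(n/2) log (2πe) + (1/2) log |K_X| - h(X) ≤ D(X‖G_X)`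
for every mean of `G_X` (`diffEntropy_of_klDiv_ne_top`). Adding this to the rate bound gives (1) and
(2), in `rateDistortion_sub_shannonLowerBound_le`. -/

namespace RateDistortion

/-! ### Divergence inequalities and product densities -/

/-- The golden-formula bound: replacing the output law by any other law `Q` can only increase the
divergence that defines mutual information. -/
lemma klDiv_compProd_prod_bind_le {α β : Type*} [MeasurableSpace α] [MeasurableSpace β]
    [StandardBorelSpace α] [Nonempty α] (μ : Measure α) [IsProbabilityMeasure μ]
    (κ : Kernel α β) [IsMarkovKernel κ] (Q : Measure β) [IsProbabilityMeasure Q] :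
    klDiv (μ.compProd κ) (μ.prod (μ.bind κ)) ≤ klDiv (μ.compProd κ) (μ.prod Q) := by
  set ν := μ.bind κ with hν
  -- With the output as first coordinate, disintegration along it and the chain rule give `D(P' ‖ Q
  -- × μ) = D(ν ‖ Q) + D(P' ‖ ν × μ)`; dropping `D(ν ‖ Q)` is the whole inequality. Swapping
  -- coordinates costs nothing, by data processing in each direction.
  set P' : Measure (β × α) := (μ.compProd κ).map Prod.swap with hP'
  have : IsProbabilityMeasure P' := Measure.isProbabilityMeasure_map measurable_swap.aemeasurable
  have hfst : P'.fst = ν := by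
    rw [hP', Measure.fst_map_swap, Measure.snd_compProd]
  have : IsProbabilityMeasure ν := by rw [← hfst]; infer_instance
  have hdis : P' = ν.compProd P'.condKernel := by
    conv_lhs => rw [← P'.disintegrate P'.condKernel, hfst]
  have hswap : P'.map Prod.swap = μ.compProd κ := by
    rw [hP', Measure.map_map measurable_swap measurable_swap]; simp
  calc klDiv (μ.compProd κ) (μ.prod ν)
      = klDiv (P'.map Prod.swap) ((ν.prod μ).map Prod.swap) := by
        rw [hswap, Measure.prod_swap]
    _ ≤ klDiv P' (ν.prod μ) := klDiv_map_le _ _ measurable_swap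
    _ ≤ klDiv P' (Q.prod μ) := by
        rw [← Measure.compProd_const (μ := ν), ← Measure.compProd_const (μ := Q), hdis,
          klDiv_compProd_eq_add ν Q]
        exact le_add_self
    _ = klDiv ((μ.compProd κ).map Prod.swap) ((μ.prod Q).map Prod.swap) := by
        rw [Measure.prod_swap]
    _ ≤ _ := klDiv_map_le _ _ measurable_swap

/-- The Radon–Nikodym derivative is `f / g`, and the mass correction in `klDiv` cancels between
probability measures. Integrability is essential, since `klDiv` is `∞` without it. The second
conclusion makes the truncation in `ENNReal.ofReal` harmless. -/
lemma klDiv_withDensity_withDensity {α : Type*} [MeasurableSpace α] (M : Measure α)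
    [SigmaFinite M] {f g : α → ℝ} (hf : Measurable f) (hg : Measurable g)
    (hf0 : ∀ x, 0 < f x) (hg0 : ∀ x, 0 < g x)
    [IsProbabilityMeasure (M.withDensity fun x => ENNReal.ofReal (f x))]
    [IsProbabilityMeasure (M.withDensity fun x => ENNReal.ofReal (g x))]
    (hint : Integrable (fun x => Real.log (f x) - Real.log (g x))
      (M.withDensity fun x => ENNReal.ofReal (f x))) :
    klDiv (M.withDensity fun x => ENNReal.ofReal (f x))
        (M.withDensity fun x => ENNReal.ofReal (g x)) =
      ENNReal.ofReal (∫ x, (Real.log (f x) - Real.log (g x))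
        ∂(M.withDensity fun x => ENNReal.ofReal (f x))) ∧
    0 ≤ ∫ x, (Real.log (f x) - Real.log (g x)) ∂(M.withDensity fun x => ENNReal.ofReal (f x)) := by
  set A := M.withDensity fun x => ENNReal.ofReal (f x) with hA
  set B := M.withDensity fun x => ENNReal.ofReal (g x) with hB
  have hAB : A = B.withDensity fun x => ENNReal.ofReal (f x / g x) := by
    rw [hA, hB, ← withDensity_mul _ (by fun_prop) (by fun_prop)]
    congr 1
    ext x
    rw [Pi.mul_apply, ← ENNReal.ofReal_mul (hg0 x).le, mul_div_cancel₀ _ (hg0 x).ne']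
  have hac : A ≪ B := by rw [hAB]; exact withDensity_absolutelyContinuous _ _
  have hrn : A.rnDeriv B =ᵐ[B] fun x => ENNReal.ofReal (f x / g x) := by
    rw [hAB]; exact Measure.rnDeriv_withDensity _ (by fun_prop)
  have hllr : llr A B =ᵐ[A] fun x => Real.log (f x) - Real.log (g x) := by
    filter_upwards [hac.ae_le hrn] with x hx
    rw [llr, hx, ENNReal.toReal_ofReal (div_pos (hf0 x) (hg0 x)).le,
      Real.log_div (hf0 x).ne' (hg0 x).ne']
  have hint' := (integrable_congr hllr).mpr hint
  have hnonneg := integral_llr_add_sub_measure_univ_nonneg hac hint'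
  rw [klDiv_of_ac_of_integrable hac hint', integral_congr_ae hllr]
  rw [integral_congr_ae hllr] at hnonneg
  simpa using hnonneg

/-- A product measure is determined by its values on boxes, and the indicator of a box factors over
the coordinates, so Fubini applies. -/
lemma pi_withDensity {ι : Type*} [Fintype ι] {f : ι → ℝ → ℝ}
    (hf0 : ∀ i x, 0 ≤ f i x) (hint : ∀ i, Integrable (f i)) :
    Measure.pi (fun i => (volume : Measure ℝ).withDensity fun x => ENNReal.ofReal (f i x)) =
      (volume : Measure (ι → ℝ)).withDensity fun x => ENNReal.ofReal (∏ i, f i (x i)) := by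
  refine Measure.pi_eq fun s hs => ?_
  have hind : ∀ i, Integrable ((s i).indicator (f i)) := fun i => (hint i).indicator (hs i)
  rw [withDensity_apply _ (MeasurableSet.univ_pi hs), ← lintegral_indicator (MeasurableSet.univ_pi hs)]
  have h1 : ∀ x : ι → ℝ, (Set.univ.pi s).indicator (fun x => ENNReal.ofReal (∏ i, f i (x i))) x =
      ENNReal.ofReal (∏ i, (s i).indicator (f i) (x i)) := by
    intro x
    by_cases hx : x ∈ Set.univ.pi s
    · rw [Set.indicator_of_mem hx]
      congr 1
      exact Finset.prod_congr rfl fun i _ => (Set.indicator_of_mem (hx i trivial) _).symm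
    · rw [Set.indicator_of_notMem hx]
      obtain ⟨i, hi⟩ : ∃ i, x i ∉ s i := by simpa using hx
      rw [Finset.prod_eq_zero (Finset.mem_univ i) (Set.indicator_of_notMem hi _)]
      simp
  simp_rw [h1]
  rw [volume_pi, ← ofReal_integral_eq_lintegral_ofReal (Integrable.fintype_prod hind)
    (.of_forall fun x => Finset.prod_nonneg fun i _ => Set.indicator_nonneg (fun y _ => hf0 i y) _),
    integral_fintype_prod_eq_prod (fun i => (s i).indicator (f i)),
    ENNReal.ofReal_prod_of_nonneg
      fun i _ => integral_nonneg fun y => Set.indicator_nonneg (fun y _ => hf0 i y) _]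
  refine Finset.prod_congr rfl fun i _ => ?_
  rw [withDensity_apply _ (hs i), integral_indicator (hs i),
    ofReal_integral_eq_lintegral_ofReal (hint i).integrableOn (.of_forall (hf0 i))]

/-- A product law on Euclidean space whose marginals have densities has the product density. -/
lemma map_toLp_pi_withDensity {ι : Type*} [Fintype ι] {f : ι → ℝ → ℝ}
    (hf : ∀ i, Measurable (f i)) (hf0 : ∀ i x, 0 ≤ f i x) (hint : ∀ i, Integrable (f i)) :
    (Measure.pi (fun i => (volume : Measure ℝ).withDensity fun x => ENNReal.ofReal (f i x))).map
        (WithLp.toLp 2) =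
      (volume : Measure (EuclideanSpace ℝ ι)).withDensity
        fun x => ENNReal.ofReal (∏ i, f i (x i)) := by
  rw [pi_withDensity hf0 hint]
  have hmp := PiLp.volume_preserving_toLp ι
  have hme : Measurable (WithLp.toLp 2 : (ι → ℝ) → EuclideanSpace ℝ ι) := hmp.measurable
  refine Measure.ext_of_lintegral _ fun F hF => ?_
  rw [lintegral_map hF hme, lintegral_withDensity_eq_lintegral_mul _ (by fun_prop) (by fun_prop),
    lintegral_withDensity_eq_lintegral_mul _ (by fun_prop) hF,
    ← hmp.lintegral_comp (by fun_prop)]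
  rfl

end RateDistortion

/-! ### The generalized normal law and its moments -/

namespace RateDistortion

/-- The normalizing constant of the density proportional to `exp (-|z|^s / (s δ))`. -/
noncomputable def genNormalConst (s δ : ℝ) : ℝ :=
  2 * Real.Gamma (1 + 1 / s) * (s * δ) ^ (1 / s)

/-- The generalized normal density, proportional to `exp (-|z|^s / (s δ))`. -/
noncomputable def genNormalPDF (s δ z : ℝ) : ℝ :=
  Real.exp (-(s * δ)⁻¹ * |z| ^ s) / genNormalConst s δ

/-- The generalized normal law on the line. -/
noncomputable def genNormal (s δ : ℝ) : Measure ℝ :=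
  volume.withDensity fun z => ENNReal.ofReal (genNormalPDF s δ z)

variable {s δ : ℝ}

lemma genNormalConst_pos (hs : 0 < s) (hδ : 0 < δ) : 0 < genNormalConst s δ := by
  have : 0 < Real.Gamma (1 + 1 / s) := Real.Gamma_pos_of_pos (by positivity)
  unfold genNormalConst
  positivity

lemma genNormalPDF_pos (hs : 0 < s) (hδ : 0 < δ) (z : ℝ) : 0 < genNormalPDF s δ z :=
  div_pos (Real.exp_pos _) (genNormalConst_pos hs hδ)

@[fun_prop]
lemma measurable_genNormalPDF : Measurable (genNormalPDF s δ) := by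
  unfold genNormalPDF
  fun_prop

lemma log_genNormalPDF (hs : 0 < s) (hδ : 0 < δ) (z : ℝ) :
    Real.log (genNormalPDF s δ z) = -(s * δ)⁻¹ * |z| ^ s - Real.log (genNormalConst s δ) := by
  rw [genNormalPDF, Real.log_div (Real.exp_pos _).ne' (genNormalConst_pos hs hδ).ne', Real.log_exp]

/-- A Gamma integral. The exponents `q = 0`, `s` and `2` yield the total mass, the moment `δ` and
the variance. -/
lemma integral_genNormalPDF_mul_rpow (hs : 0 < s) (hδ : 0 < δ) {q : ℝ} (hq : -1 < q) :
    ∫ z, genNormalPDF s δ z * |z| ^ q =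
      (s * δ) ^ (q / s) * Real.Gamma ((q + 1) / s) / Real.Gamma (1 / s) := by
  have hb : 0 < s * δ := by positivity
  have hG : 0 < Real.Gamma (1 / s) := Real.Gamma_pos_of_pos (by positivity)
  have h1 : ∀ z, genNormalPDF s δ z * |z| ^ q =
      (|z| ^ q * Real.exp (-(s * δ)⁻¹ * |z| ^ s)) * (genNormalConst s δ)⁻¹ := fun z => by
    rw [genNormalPDF]; ring
  simp_rw [h1]
  rw [integral_mul_const, integral_comp_abs (f := fun x => x ^ q * Real.exp (-(s * δ)⁻¹ * x ^ s)),
    integral_rpow_mul_exp_neg_mul_rpow hs hq (by positivity), genNormalConst, add_comm 1,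
    Real.Gamma_add_one (by positivity), Real.inv_rpow hb.le, ← Real.rpow_neg hb.le,
    show -(-(q + 1) / s) = q / s + 1 / s by ring, Real.rpow_add hb]
  have := Real.rpow_pos_of_pos hb (1 / s)
  field_simp

lemma integrable_genNormalPDF_mul_rpow (hs : 0 < s) (hδ : 0 < δ) {q : ℝ} (hq : -1 < q) :
    Integrable fun z => genNormalPDF s δ z * |z| ^ q := by
  have h1 : 0 < Real.Gamma (1 / s) := Real.Gamma_pos_of_pos (by positivity)
  have h2 : 0 < Real.Gamma ((q + 1) / s) := Real.Gamma_pos_of_pos (div_pos (by linarith) hs)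
  -- A non-integrable function has Bochner integral zero by convention, so a positive value proves
  -- integrability.
  refine Integrable.of_integral_ne_zero ?_
  rw [integral_genNormalPDF_mul_rpow hs hδ hq]
  positivity

lemma integrable_genNormalPDF (hs : 0 < s) (hδ : 0 < δ) : Integrable (genNormalPDF s δ) := by
  simpa using integrable_genNormalPDF_mul_rpow hs hδ (q := 0) (by norm_num)

lemma isProbabilityMeasure_genNormal (hs : 0 < s) (hδ : 0 < δ) :
    IsProbabilityMeasure (genNormal s δ) := by
  have hG : 0 < Real.Gamma (1 / s) := Real.Gamma_pos_of_pos (by positivity)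
  have h : ∫ z, genNormalPDF s δ z = 1 := by
    have := integral_genNormalPDF_mul_rpow hs hδ (q := 0) (by norm_num)
    simpa [← one_div, div_self hG.ne'] using this
  constructor
  rw [genNormal, withDensity_apply _ MeasurableSet.univ, Measure.restrict_univ,
    ← ofReal_integral_eq_lintegral_ofReal (integrable_genNormalPDF hs hδ)
      (.of_forall fun z => (genNormalPDF_pos hs hδ z).le), h, ENNReal.ofReal_one]

lemma integral_genNormal (hs : 0 < s) (hδ : 0 < δ) (F : ℝ → ℝ) :
    ∫ z, F z ∂(genNormal s δ) = ∫ z, genNormalPDF s δ z * F z := by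
  rw [genNormal, integral_withDensity_eq_integral_toReal_smul (by fun_prop) (by simp)]
  simp [ENNReal.toReal_ofReal (genNormalPDF_pos hs hδ _).le]

lemma integrable_genNormal_iff (hs : 0 < s) (hδ : 0 < δ) (F : ℝ → ℝ) :
    Integrable F (genNormal s δ) ↔ Integrable fun z => genNormalPDF s δ z * F z := by
  rw [genNormal, integrable_withDensity_iff_integrable_smul' (by fun_prop) (by simp)]
  simp [ENNReal.toReal_ofReal (genNormalPDF_pos hs hδ _).le]

lemma integrable_rpow_genNormal (hs : 0 < s) (hδ : 0 < δ) {q : ℝ} (hq : -1 < q) :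
    Integrable (fun z => |z| ^ q) (genNormal s δ) :=
  (integrable_genNormal_iff hs hδ _).2 (integrable_genNormalPDF_mul_rpow hs hδ hq)

/-- The order-`s` moment of the generalized normal law is its parameter `δ`. -/
lemma integral_rpow_genNormal (hs : 0 < s) (hδ : 0 < δ) :
    ∫ z, |z| ^ s ∂(genNormal s δ) = δ := by
  have hG : 0 < Real.Gamma (1 / s) := Real.Gamma_pos_of_pos (by positivity)
  rw [integral_genNormal hs hδ, integral_genNormalPDF_mul_rpow hs hδ (by linarith),
    div_self hs.ne', Real.rpow_one, show (s + 1) / s = 1 / s + 1 by field_simp; ring,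
    Real.Gamma_add_one (by positivity)]
  field_simp

lemma integrable_sq_genNormal (hs : 0 < s) (hδ : 0 < δ) :
    Integrable (fun z => z ^ 2) (genNormal s δ) := by
  simpa using integrable_rpow_genNormal hs hδ (q := 2) (by norm_num)

lemma integral_sq_genNormal (hs : 0 < s) (hδ : 0 < δ) :
    ∫ z, z ^ 2 ∂(genNormal s δ) =
      (s * δ) ^ (2 / s) * Real.Gamma (3 / s) / Real.Gamma (1 / s) := by
  have := integral_genNormalPDF_mul_rpow hs hδ (q := 2) (by norm_num)
  rw [← integral_genNormal hs hδ] at this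
  norm_num at this ⊢
  exact this

lemma integrable_id_genNormal (hs : 0 < s) (hδ : 0 < δ) :
    Integrable (fun z => z) (genNormal s δ) := by
  have h := integrable_rpow_genNormal hs hδ (q := 1) (by norm_num)
  simp only [Real.rpow_one] at h
  exact (integrable_norm_iff (by fun_prop)).1 h

lemma integral_id_genNormal (hs : 0 < s) (hδ : 0 < δ) :
    ∫ z, z ∂(genNormal s δ) = 0 := by
  rw [integral_genNormal hs hδ]
  have h := integral_neg_eq_self (fun z => genNormalPDF s δ z * z) volume
  have h2 : ∀ z, genNormalPDF s δ (-z) * -z = -(genNormalPDF s δ z * z) := fun z => by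
    simp [genNormalPDF]
  simp_rw [h2, integral_neg] at h
  linarith

end RateDistortion

/-! ### The additive noise channel: mutual information and distortion -/

namespace RateDistortion

/-- The density of a vector with independent generalized normal coordinates. -/
noncomputable def noisePDF {n : ℕ} (s δ : ℝ) (z : EuclideanSpace ℝ (Fin n)) : ℝ :=
  ∏ i, genNormalPDF s δ (z i)

/-- The law of a vector with independent generalized normal coordinates. -/
noncomputable def noiseLaw (n : ℕ) (s δ : ℝ) : Measure (EuclideanSpace ℝ (Fin n)) :=
  (Measure.pi fun _ => genNormal s δ).map (WithLp.toLp 2)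

/-- The channel sending `x` to `a x + Z` with `Z` generalized normal noise. -/
noncomputable def noiseChannel (n : ℕ) (s δ a : ℝ) :
    Kernel (EuclideanSpace ℝ (Fin n)) (EuclideanSpace ℝ (Fin n)) :=
  (Kernel.id ×ₖ Kernel.const _ (noiseLaw n s δ)).map fun p => a • p.1 + p.2

variable {n : ℕ} {s δ a : ℝ}

lemma isProbabilityMeasure_noiseLaw (hs : 0 < s) (hδ : 0 < δ) :
    IsProbabilityMeasure (noiseLaw n s δ) := by
  have := isProbabilityMeasure_genNormal hs hδ
  exact Measure.isProbabilityMeasure_map (by fun_prop)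

lemma isMarkovKernel_noiseChannel (hs : 0 < s) (hδ : 0 < δ) :
    IsMarkovKernel (noiseChannel n s δ a) := by
  have := isProbabilityMeasure_noiseLaw (n := n) hs hδ
  exact Kernel.IsMarkovKernel.map _ (by fun_prop)

@[fun_prop]
lemma measurable_noisePDF : Measurable (noisePDF (n := n) s δ) := by
  unfold noisePDF
  fun_prop

lemma noisePDF_pos (hs : 0 < s) (hδ : 0 < δ) (z : EuclideanSpace ℝ (Fin n)) :
    0 < noisePDF s δ z :=
  Finset.prod_pos fun _ _ => genNormalPDF_pos hs hδ _

lemma log_noisePDF (hs : 0 < s) (hδ : 0 < δ) (z : EuclideanSpace ℝ (Fin n)) :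
    Real.log (noisePDF s δ z) =
      ∑ i, (-(s * δ)⁻¹ * |z i| ^ s - Real.log (genNormalConst s δ)) := by
  rw [noisePDF, Real.log_prod fun i _ => (genNormalPDF_pos hs hδ _).ne']
  simp_rw [log_genNormalPDF hs hδ]

lemma noiseLaw_eq_withDensity (hs : 0 < s) (hδ : 0 < δ) :
    noiseLaw n s δ = volume.withDensity fun z => ENNReal.ofReal (noisePDF s δ z) :=
  map_toLp_pi_withDensity (fun _ => measurable_genNormalPDF)
    (fun _ z => (genNormalPDF_pos hs hδ z).le) fun _ => integrable_genNormalPDF hs hδ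

/-- Expectations under the channel become expectations over an independent pair (signal, noise); the
density form below serves the divergence instead. -/
lemma compProd_noiseChannel_eq_map (hs : 0 < s) (hδ : 0 < δ)
    (μ : Measure (EuclideanSpace ℝ (Fin n))) [IsProbabilityMeasure μ] :
    μ.compProd (noiseChannel n s δ a) =
      (μ.prod (noiseLaw n s δ)).map fun p => (p.1, a • p.1 + p.2) := by
  have := isProbabilityMeasure_noiseLaw (n := n) hs hδ
  have := isMarkovKernel_noiseChannel (n := n) (a := a) hs hδ
  refine Measure.ext_of_lintegral _ fun F hF => ?_
  rw [Measure.lintegral_compProd hF, lintegral_map hF (by fun_prop),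
    lintegral_prod _ (by fun_prop)]
  refine lintegral_congr fun x => ?_
  rw [noiseChannel, Kernel.lintegral_map _ (by fun_prop) _ (by fun_prop),
    Kernel.lintegral_prod _ _ _ (by fun_prop), Kernel.id_apply, lintegral_dirac, Kernel.const_apply]

/-- Translation invariance of Lebesgue measure absorbs the shift by `a • x`. The reference measure
`μ.prod volume` also carries `μ.prod Q`, so no density of `μ` is ever required. -/
lemma compProd_noiseChannel_eq_withDensity (hs : 0 < s) (hδ : 0 < δ)
    (μ : Measure (EuclideanSpace ℝ (Fin n))) [IsProbabilityMeasure μ] :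
    μ.compProd (noiseChannel n s δ a) =
      (μ.prod volume).withDensity fun p => ENNReal.ofReal (noisePDF s δ (p.2 - a • p.1)) := by
  have := isProbabilityMeasure_noiseLaw (n := n) hs hδ
  rw [compProd_noiseChannel_eq_map hs hδ]
  refine Measure.ext_of_lintegral _ fun F hF => ?_
  rw [lintegral_map hF (by fun_prop), lintegral_prod _ (by fun_prop),
    lintegral_withDensity_eq_lintegral_mul _ (by fun_prop) hF, lintegral_prod _ (by fun_prop)]
  refine lintegral_congr fun x => ?_
  rw [noiseLaw_eq_withDensity hs hδ,
    lintegral_withDensity_eq_lintegral_mul _ (by fun_prop) (by fun_prop)]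
  conv_rhs => rw [← lintegral_add_left_eq_self _ (a • x)]
  simp

lemma prod_noiseLaw_eq_withDensity (hs : 0 < s) (hδ : 0 < δ)
    (μ : Measure (EuclideanSpace ℝ (Fin n))) [IsProbabilityMeasure μ] :
    μ.prod (noiseLaw n s δ) =
      (μ.prod volume).withDensity fun p => ENNReal.ofReal (noisePDF s δ p.2) := by
  rw [noiseLaw_eq_withDensity hs hδ, prod_withDensity_right (by fun_prop)]

lemma measurePreserving_apply_noiseLaw (hs : 0 < s) (hδ : 0 < δ) (i : Fin n) :
    MeasurePreserving (fun z : EuclideanSpace ℝ (Fin n) => z i) (noiseLaw n s δ)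
      (genNormal s δ) := by
  have := isProbabilityMeasure_genNormal hs hδ
  refine ⟨by fun_prop, ?_⟩
  rw [noiseLaw, Measure.map_map (by fun_prop) (by fun_prop)]
  exact (measurePreserving_eval (fun _ : Fin n => genNormal s δ) i).map_eq

section Moments

variable {μ : Measure (EuclideanSpace ℝ (Fin n))} [IsProbabilityMeasure μ]

lemma measurePreserving_snd_apply (hs : 0 < s) (hδ : 0 < δ) (i : Fin n) :
    MeasurePreserving (fun p : EuclideanSpace ℝ (Fin n) × EuclideanSpace ℝ (Fin n) => p.2 i)
      (μ.prod (noiseLaw n s δ)) (genNormal s δ) := by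
  have := isProbabilityMeasure_noiseLaw (n := n) hs hδ
  exact (measurePreserving_apply_noiseLaw hs hδ i).comp measurePreserving_snd

lemma integrable_noise_rpow (hs : 0 < s) (hδ : 0 < δ) (i : Fin n) :
    Integrable (fun p : EuclideanSpace ℝ (Fin n) × EuclideanSpace ℝ (Fin n) => |p.2 i| ^ s)
      (μ.prod (noiseLaw n s δ)) :=
  (measurePreserving_snd_apply hs hδ i).integrable_comp_of_integrable
    (integrable_rpow_genNormal hs hδ (by linarith))

lemma integral_noise_rpow (hs : 0 < s) (hδ : 0 < δ) (i : Fin n) :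
    ∫ p, |p.2 i| ^ s ∂(μ.prod (noiseLaw n s δ)) = δ := by
  have h := measurePreserving_snd_apply (μ := μ) hs hδ i
  conv_rhs => rw [← integral_rpow_genNormal hs hδ, ← h.map_eq]
  rw [integral_map h.measurable.aemeasurable]
  exact Measurable.aestronglyMeasurable (by fun_prop)

lemma integrable_coord (hX : ∀ i, Integrable (fun x => x i ^ 2) μ) (i : Fin n) :
    Integrable (fun x => x i) μ := by
  have hm : Measurable fun x : EuclideanSpace ℝ (Fin n) => x i := by fun_prop
  exact ((memLp_two_iff_integrable_sq hm.aestronglyMeasurable).2 (hX i)).integrable one_le_two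

/-- The cross term vanishes because the noise is centred and independent of the signal, whatever the
mean of the signal. It serves for the output with `b = a` and for the error with `b = a - 1`. -/
lemma hasIntegral_signal_add_noise_sq (hs : 0 < s) (hδ : 0 < δ)
    (hX : ∀ i, Integrable (fun x => x i ^ 2) μ) (b : ℝ) (i : Fin n) :
    Integrable (fun p : EuclideanSpace ℝ (Fin n) × EuclideanSpace ℝ (Fin n) =>
        (b * p.1 i + p.2 i) ^ 2) (μ.prod (noiseLaw n s δ)) ∧
      ∫ p, (b * p.1 i + p.2 i) ^ 2 ∂(μ.prod (noiseLaw n s δ)) =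
        b ^ 2 * ∫ x, x i ^ 2 ∂μ + ∫ z, z ^ 2 ∂(genNormal s δ) := by
  have := isProbabilityMeasure_noiseLaw (n := n) hs hδ
  have hZ := measurePreserving_apply_noiseLaw (n := n) hs hδ i
  have i1 : Integrable (fun p : EuclideanSpace ℝ (Fin n) × EuclideanSpace ℝ (Fin n) =>
      b ^ 2 * p.1 i ^ 2) (μ.prod (noiseLaw n s δ)) :=
    ((hX i).comp_fst (noiseLaw n s δ)).const_mul _
  have iz2 : Integrable (fun z : EuclideanSpace ℝ (Fin n) => z i ^ 2) (noiseLaw n s δ) :=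
    hZ.integrable_comp_of_integrable (integrable_sq_genNormal hs hδ)
  have iz1 : Integrable (fun z : EuclideanSpace ℝ (Fin n) => z i) (noiseLaw n s δ) :=
    hZ.integrable_comp_of_integrable (integrable_id_genNormal hs hδ)
  have i2 : Integrable (fun p : EuclideanSpace ℝ (Fin n) × EuclideanSpace ℝ (Fin n) =>
      p.2 i ^ 2) (μ.prod (noiseLaw n s δ)) := iz2.comp_snd μ
  have i3 : Integrable (fun p : EuclideanSpace ℝ (Fin n) × EuclideanSpace ℝ (Fin n) =>
      2 * b * (p.1 i * p.2 i)) (μ.prod (noiseLaw n s δ)) :=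
    ((integrable_coord hX i).mul_prod iz1).const_mul _
  have i13 : Integrable (fun p : EuclideanSpace ℝ (Fin n) × EuclideanSpace ℝ (Fin n) =>
      b ^ 2 * p.1 i ^ 2 + 2 * b * (p.1 i * p.2 i)) (μ.prod (noiseLaw n s δ)) := i1.add i3
  have e : ∀ p : EuclideanSpace ℝ (Fin n) × EuclideanSpace ℝ (Fin n),
      (b * p.1 i + p.2 i) ^ 2 = b ^ 2 * p.1 i ^ 2 + 2 * b * (p.1 i * p.2 i) + p.2 i ^ 2 :=
    fun p => by ring
  have m1 : ∫ z : EuclideanSpace ℝ (Fin n), z i ∂(noiseLaw n s δ) = 0 := by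
    rw [← integral_id_genNormal hs hδ, ← hZ.map_eq, integral_map hZ.measurable.aemeasurable]
    exact Measurable.aestronglyMeasurable (by fun_prop)
  have m2 : ∫ z : EuclideanSpace ℝ (Fin n), z i ^ 2 ∂(noiseLaw n s δ) =
      ∫ z, z ^ 2 ∂(genNormal s δ) := by
    rw [← hZ.map_eq, integral_map hZ.measurable.aemeasurable]
    exact Measurable.aestronglyMeasurable (by fun_prop)
  simp_rw [e]
  refine ⟨i13.add i2, ?_⟩
  rw [integral_add i13 i2, integral_add i1 i3, integral_const_mul, integral_const_mul,
    integral_prod_mul (fun x : EuclideanSpace ℝ (Fin n) => x i)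
      (fun x : EuclideanSpace ℝ (Fin n) => x i), m1,
    integral_fun_fst (fun x : EuclideanSpace ℝ (Fin n) => x i ^ 2),
    integral_fun_snd (fun x : EuclideanSpace ℝ (Fin n) => x i ^ 2), m2]
  simp

/-- The mutual information across the channel `x ↦ a x + Z` is at most the entropy of the Gaussian
law with the second moment of the output minus the entropy of the noise. -/
lemma mutualInfo_noiseChannel_le (hn : 1 ≤ n) (hs : 0 < s) (hδ : 0 < δ)
    (hX : ∀ i, Integrable (fun x => x i ^ 2) μ) {τ : ℝ} (hτ : 0 < τ)
    (hτ2 : a ^ 2 * (∑ i, ∫ x, x i ^ 2 ∂μ) + n * ∫ z, z ^ 2 ∂(genNormal s δ) = n * τ) :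
    (mutualInfo μ (noiseChannel n s δ a) : EReal) ≤
      ((n * (Real.log (genNormalConst 2 τ) + 1 / 2
        - (Real.log (genNormalConst s δ) + 1 / s)) : ℝ) : EReal) := by
  have := isProbabilityMeasure_noiseLaw (n := n) hs hδ
  have := isProbabilityMeasure_noiseLaw (n := n) two_pos hτ
  have := isMarkovKernel_noiseChannel (n := n) (a := a) hs hδ
  -- The output law is replaced by the Gaussian of variance `τ`. By `hτ2` its quadratic exponent
  -- then has expectation exactly `n / 2`, matching `n / s` for the noise.
  refine (EReal.coe_ennreal_le_coe_ennreal_iff.2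
    (klDiv_compProd_prod_bind_le μ _ (noiseLaw n 2 τ))).trans ?_
  have hP := compProd_noiseChannel_eq_withDensity (a := a) hs hδ μ
  have hQ := prod_noiseLaw_eq_withDensity two_pos hτ μ
  have pP : IsProbabilityMeasure ((μ.prod volume).withDensity
      fun p => ENNReal.ofReal (noisePDF s δ (p.2 - a • p.1))) := by
    rw [← hP]; infer_instance
  have pQ : IsProbabilityMeasure ((μ.prod volume).withDensity
      fun p : EuclideanSpace ℝ (Fin n) × EuclideanSpace ℝ (Fin n) =>
        ENNReal.ofReal (noisePDF 2 τ p.2)) := by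
    rw [← hQ]; infer_instance
  -- In the coordinates (signal, noise) the log-likelihood ratio is a sum of terms with known
  -- moments.
  have hL : ∀ p : EuclideanSpace ℝ (Fin n) × EuclideanSpace ℝ (Fin n),
      Real.log (noisePDF s δ ((a • p.1 + p.2) - a • p.1)) - Real.log (noisePDF 2 τ (a • p.1 + p.2)) =
      ∑ i, ((-(s * δ)⁻¹ * |p.2 i| ^ s + (2 * τ)⁻¹ * (a * p.1 i + p.2 i) ^ 2) +
        (Real.log (genNormalConst 2 τ) - Real.log (genNormalConst s δ))) := by
    intro p
    rw [log_noisePDF hs hδ, log_noisePDF two_pos hτ, ← Finset.sum_sub_distrib]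
    refine Finset.sum_congr rfl fun i _ => ?_
    simp only [add_sub_cancel_left, PiLp.add_apply, PiLp.smul_apply, smul_eq_mul, Real.rpow_two,
      sq_abs]
    ring
  have hi : ∀ i, Integrable
      (fun p : EuclideanSpace ℝ (Fin n) × EuclideanSpace ℝ (Fin n) =>
      (-(s * δ)⁻¹ * |p.2 i| ^ s + (2 * τ)⁻¹ * (a * p.1 i + p.2 i) ^ 2) +
        (Real.log (genNormalConst 2 τ) - Real.log (genNormalConst s δ)))
      (μ.prod (noiseLaw n s δ)) := fun i =>
    (((integrable_noise_rpow hs hδ i).const_mul _).add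
      ((hasIntegral_signal_add_noise_sq hs hδ hX a i).1.const_mul _)).add (integrable_const _)
  have hmeas : Measurable fun p : EuclideanSpace ℝ (Fin n) × EuclideanSpace ℝ (Fin n) =>
      Real.log (noisePDF s δ (p.2 - a • p.1)) - Real.log (noisePDF 2 τ p.2) := by fun_prop
  have hint : Integrable (fun p : EuclideanSpace ℝ (Fin n) × EuclideanSpace ℝ (Fin n) =>
      Real.log (noisePDF s δ (p.2 - a • p.1)) - Real.log (noisePDF 2 τ p.2))
      (μ.compProd (noiseChannel n s δ a)) := by
    rw [compProd_noiseChannel_eq_map hs hδ, integrable_map_measure hmeas.aestronglyMeasurable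
      (by fun_prop)]
    refine (integrable_finsetSum Finset.univ fun i _ => hi i).congr (.of_forall fun p => ?_)
    simp only [Function.comp]
    exact (hL p).symm
  have hval : ∫ p, (Real.log (noisePDF s δ (p.2 - a • p.1)) - Real.log (noisePDF 2 τ p.2))
      ∂(μ.compProd (noiseChannel n s δ a)) = n * (Real.log (genNormalConst 2 τ) + 1 / 2
        - (Real.log (genNormalConst s δ) + 1 / s)) := by
    rw [compProd_noiseChannel_eq_map hs hδ, integral_map (by fun_prop) hmeas.aestronglyMeasurable]
    simp_rw [hL]
    rw [integral_finsetSum _ fun i _ => hi i]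
    have : ∀ i : Fin n, ∫ p, ((-(s * δ)⁻¹ * |p.2 i| ^ s + (2 * τ)⁻¹ * (a * p.1 i + p.2 i) ^ 2) +
        (Real.log (genNormalConst 2 τ) - Real.log (genNormalConst s δ)))
        ∂(μ.prod (noiseLaw n s δ)) =
        (2 * τ)⁻¹ * (a ^ 2 * ∫ x, x i ^ 2 ∂μ + ∫ z, z ^ 2 ∂(genNormal s δ)) + (-(s * δ)⁻¹ * δ +
          (Real.log (genNormalConst 2 τ) - Real.log (genNormalConst s δ))) := by
      intro i
      have j1 := (integrable_noise_rpow (μ := μ) hs hδ i).const_mul (-(s * δ)⁻¹)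
      have j2 := (hasIntegral_signal_add_noise_sq hs hδ hX a i).1.const_mul (2 * τ)⁻¹
      have j12 : Integrable (fun p : EuclideanSpace ℝ (Fin n) × EuclideanSpace ℝ (Fin n) =>
          -(s * δ)⁻¹ * |p.2 i| ^ s + (2 * τ)⁻¹ * (a * p.1 i + p.2 i) ^ 2)
          (μ.prod (noiseLaw n s δ)) := j1.add j2
      rw [integral_add j12 (integrable_const _), integral_add j1 j2, integral_const_mul,
        integral_const_mul, integral_noise_rpow hs hδ,
        (hasIntegral_signal_add_noise_sq hs hδ hX a i).2]
      simp
      ring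
    simp_rw [this]
    rw [Finset.sum_add_distrib, ← Finset.mul_sum, Finset.sum_add_distrib, ← Finset.mul_sum]
    simp only [Finset.sum_const, Finset.card_univ, Fintype.card_fin, nsmul_eq_mul]
    rw [hτ2]
    field_simp
    ring
  rw [hP] at hint hval ⊢
  obtain ⟨h1, h2⟩ := klDiv_withDensity_withDensity (μ.prod volume) (by fun_prop) (by fun_prop)
    (fun p => noisePDF_pos hs hδ _) (fun p => noisePDF_pos two_pos hτ _) hint
  rw [hQ, h1, EReal.coe_ennreal_ofReal, max_eq_left h2, hval]

end Moments

/-- The distortion of the noise channel as an expectation over the signal and the noise. -/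
lemma distortion_noiseChannel (hs : 0 < s) (hδ : 0 < δ)
    (μ : Measure (EuclideanSpace ℝ (Fin n))) [IsProbabilityMeasure μ] (r : ℝ) :
    distortion r μ (noiseChannel n s δ a) =
      (∑ i, ∫⁻ p, ENNReal.ofReal (|(a - 1) * p.1 i + p.2 i| ^ r) ∂(μ.prod (noiseLaw n s δ))) / n := by
  have := isProbabilityMeasure_noiseLaw (n := n) hs hδ
  have := isMarkovKernel_noiseChannel (n := n) (a := a) hs hδ
  rw [distortion, ← lintegral_finsetSum _ (fun i _ => by fun_prop),
    ← Measure.lintegral_compProd (f := fun p : EuclideanSpace ℝ (Fin n) × EuclideanSpace ℝ (Fin n) =>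
      ∑ i, ENNReal.ofReal (|p.1 i - p.2 i| ^ r)) (by fun_prop),
    compProd_noiseChannel_eq_map hs hδ, lintegral_map (by fun_prop) (by fun_prop)]
  congr 1
  refine lintegral_congr fun p => Finset.sum_congr rfl fun i _ => ?_
  rw [abs_sub_comm]
  simp only [PiLp.add_apply, PiLp.smul_apply, smul_eq_mul]
  ring_nf

lemma distortion_noiseChannel_one (hn : 1 ≤ n) (hs : 0 < s) (hδ : 0 < δ)
    (μ : Measure (EuclideanSpace ℝ (Fin n))) [IsProbabilityMeasure μ] :
    distortion s μ (noiseChannel n s δ 1) = ENNReal.ofReal δ := by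
  rw [distortion_noiseChannel hs hδ]
  simp only [sub_self, zero_mul, zero_add]
  have : ∀ i, ∫⁻ p, ENNReal.ofReal (|p.2 i| ^ s) ∂(μ.prod (noiseLaw n s δ)) = ENNReal.ofReal δ :=
    fun i => by
      rw [← ofReal_integral_eq_lintegral_ofReal (integrable_noise_rpow hs hδ i)
        (.of_forall fun p => by positivity), integral_noise_rpow hs hδ]
  simp_rw [this]
  rw [Finset.sum_const, Finset.card_univ, Fintype.card_fin, nsmul_eq_mul]
  rw [mul_comm]
  exact ENNReal.mul_div_cancel_right (by positivity) (by simp)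

lemma distortion_two_noiseChannel (hn : 1 ≤ n) (hs : 0 < s) (hδ : 0 < δ)
    (μ : Measure (EuclideanSpace ℝ (Fin n))) [IsProbabilityMeasure μ]
    (hX : ∀ i, Integrable (fun x => x i ^ 2) μ) :
    distortion 2 μ (noiseChannel n s δ a) =
      ENNReal.ofReal ((a - 1) ^ 2 * ((∑ i, ∫ x, x i ^ 2 ∂μ) / n) +
        ∫ z, z ^ 2 ∂(genNormal s δ)) := by
  rw [distortion_noiseChannel hs hδ]
  have : ∀ i, ∫⁻ p, ENNReal.ofReal (|(a - 1) * p.1 i + p.2 i| ^ (2 : ℝ))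
      ∂(μ.prod (noiseLaw n s δ)) = ENNReal.ofReal ((a - 1) ^ 2 * ∫ x, x i ^ 2 ∂μ +
        ∫ z, z ^ 2 ∂(genNormal s δ)) := fun i => by
    obtain ⟨h1, h2⟩ := hasIntegral_signal_add_noise_sq hs hδ hX (a - 1) i
    simp only [Real.rpow_two, sq_abs]
    rw [← ofReal_integral_eq_lintegral_ofReal h1 (.of_forall fun p => by positivity), h2]
  have hv : 0 ≤ ∫ z, z ^ 2 ∂(genNormal s δ) := integral_nonneg fun z => by positivity
  have hx : ∀ i, 0 ≤ ∫ x, x i ^ 2 ∂μ := fun i => integral_nonneg fun x => by positivity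
  simp_rw [this]
  rw [← ENNReal.ofReal_sum_of_nonneg fun i _ => by have := hx i; positivity,
    ← ENNReal.ofReal_natCast n, ← ENNReal.ofReal_div_of_pos (by positivity),
    Finset.sum_add_distrib, ← Finset.mul_sum]
  congr 1
  simp only [Finset.sum_const, Finset.card_univ, Fintype.card_fin, nsmul_eq_mul]
  field_simp

end RateDistortion

/-! ### Gaussian densities, whitening and differential entropy -/

namespace RateDistortion

open scoped MatrixOrder
open Matrix (toEuclideanCLM)

variable {n : ℕ}

lemma genNormalConst_two (τ : ℝ) : genNormalConst 2 τ = √(2 * Real.pi * τ) := by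
  rw [genNormalConst, add_comm, Real.Gamma_add_one (by norm_num), Real.Gamma_one_half_eq,
    ← Real.sqrt_eq_rpow, show 2 * Real.pi * τ = Real.pi * (2 * τ) by ring,
    Real.sqrt_mul Real.pi_pos.le]
  ring

lemma gaussianReal_eq_genNormal : gaussianReal 0 1 = genNormal 2 1 := by
  rw [gaussianReal_of_var_ne_zero _ one_ne_zero, genNormal]
  congr 1
  ext x
  rw [gaussianPDF, gaussianPDFReal, genNormalPDF, genNormalConst_two]
  simp only [NNReal.coe_one, sub_zero, mul_one, Real.rpow_two, sq_abs]
  congr 1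
  rw [neg_mul, div_eq_inv_mul, mul_neg, div_eq_inv_mul]

lemma stdGaussian_eq_noiseLaw : stdGaussian (EuclideanSpace ℝ (Fin n)) = noiseLaw n 2 1 := by
  rw [← map_pi_eq_stdGaussian, gaussianReal_eq_genNormal, noiseLaw]

/-- The density of a nondegenerate Gaussian law. -/
lemma multivariateGaussian_eq_withDensity (m : EuclideanSpace ℝ (Fin n))
    {K : Matrix (Fin n) (Fin n) ℝ} (hA : 0 < (CFC.sqrt K).det) :
    multivariateGaussian m K = volume.withDensity fun x => ENNReal.ofReal
      ((CFC.sqrt K).det⁻¹ * noisePDF 2 1 (toEuclideanCLM (𝕜 := ℝ) (CFC.sqrt K)⁻¹ (x - m))) := by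
  set A := CFC.sqrt K
  have hu : IsUnit A.det := hA.ne'.isUnit
  have hinv : ∀ z, toEuclideanCLM (𝕜 := ℝ) A⁻¹ (toEuclideanCLM (𝕜 := ℝ) A z) = z := fun z => by
    rw [← mul_apply_eq_comp, ← map_mul, Matrix.nonsing_inv_mul _ hu, map_one]
    rfl
  have hdet : LinearMap.det
      ((toEuclideanCLM (n := Fin n) (𝕜 := ℝ) A : EuclideanSpace ℝ (Fin n) →L[ℝ] _) :
        EuclideanSpace ℝ (Fin n) →ₗ[ℝ] EuclideanSpace ℝ (Fin n)) = A.det := by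
    rw [Matrix.coe_toEuclideanCLM_eq_toEuclideanLin]
    exact LinearMap.det_toLpLin 2 A
  have hmap := Measure.map_linearMap_addHaar_eq_smul_addHaar
    (volume : Measure (EuclideanSpace ℝ (Fin n))) (hdet ▸ hA.ne')
  rw [hdet, abs_of_pos (inv_pos.2 hA)] at hmap
  refine Measure.ext_of_lintegral _ fun F hF => ?_
  rw [multivariateGaussian, lintegral_map hF (by fun_prop), stdGaussian_eq_noiseLaw,
    noiseLaw_eq_withDensity two_pos one_pos,
    lintegral_withDensity_eq_lintegral_mul _ (by fun_prop) (by fun_prop),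
    lintegral_withDensity_eq_lintegral_mul _ (by fun_prop) hF]
  conv_rhs => rw [← lintegral_add_left_eq_self _ m]
  have hG : Measurable fun y : EuclideanSpace ℝ (Fin n) =>
      ENNReal.ofReal (noisePDF 2 1 (toEuclideanCLM (𝕜 := ℝ) A⁻¹ y)) * F (m + y) := by fun_prop
  -- Writing `z = A⁻¹ (A z)` makes the integrand a function of `A z`, so the linear change of
  -- variables applies and produces the factor `A.det⁻¹`.
  calc _ = ∫⁻ z, ENNReal.ofReal (noisePDF 2 1 (toEuclideanCLM (𝕜 := ℝ) A⁻¹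
          (toEuclideanCLM (𝕜 := ℝ) A z))) * F (m + toEuclideanCLM (𝕜 := ℝ) A z) := by
        simp_rw [hinv]; rfl
    _ = ENNReal.ofReal A.det⁻¹ * ∫⁻ y, ENNReal.ofReal (noisePDF 2 1
          (toEuclideanCLM (𝕜 := ℝ) A⁻¹ y)) * F (m + y) := by
        rw [← smul_eq_mul (ENNReal.ofReal _) (lintegral _ _), ← lintegral_smul_measure, ← hmap]
        exact (lintegral_map hG (ContinuousLinearMap.measurable _)).symm
    _ = _ := by
        rw [← lintegral_const_mul _ hG]
        refine lintegral_congr fun y => ?_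
        rw [Pi.mul_apply, add_sub_cancel_left, ENNReal.ofReal_mul (inv_pos.2 hA).le, mul_assoc]

section Covariance

variable {μ : Measure (EuclideanSpace ℝ (Fin n))}

lemma memLp_coord (hX : ∀ i, Integrable (fun x => x i ^ 2) μ) (i : Fin n) :
    MemLp (fun x => x i) 2 μ := by
  have hm : Measurable fun x : EuclideanSpace ℝ (Fin n) => x i := by fun_prop
  exact (memLp_two_iff_integrable_sq hm.aestronglyMeasurable).2 (hX i)

variable [IsProbabilityMeasure μ]

lemma variance_linear (hX : ∀ i, Integrable (fun x => x i ^ 2) μ) (b : Fin n → ℝ) :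
    variance (fun x => ∑ j, b j * x j) μ = ∑ j, ∑ k, b j * b k * covMatrix μ j k := by
  have hm : Measurable fun x : EuclideanSpace ℝ (Fin n) => ∑ j, b j * x j := by fun_prop
  rw [← covariance_self hm.aemeasurable,
    covariance_fun_sum_fun_sum (fun j => (memLp_coord hX j).const_mul (b j))
      (fun j => (memLp_coord hX j).const_mul (b j))]
  refine Finset.sum_congr rfl fun j _ => Finset.sum_congr rfl fun k _ => ?_
  rw [covariance_const_mul_left, covariance_const_mul_right, covMatrix, Matrix.of_apply]
  ring

lemma covMatrix_posSemidef (hX : ∀ i, Integrable (fun x => x i ^ 2) μ) :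
    (covMatrix μ).PosSemidef := by
  refine .of_dotProduct_mulVec_nonneg ?_ fun b => ?_
  · ext i j
    exact covariance_comm _ _
  · have h := variance_nonneg (fun x : EuclideanSpace ℝ (Fin n) => ∑ j, b j * x j) μ
    rw [variance_linear hX] at h
    refine h.trans_eq ?_
    simp only [dotProduct, Matrix.mulVec, Pi.star_apply, star_trivial, Finset.mul_sum]
    exact Finset.sum_congr rfl fun j _ => Finset.sum_congr rfl fun k _ => by ring

lemma sqrt_covMatrix_det_pos (hX : ∀ i, Integrable (fun x => x i ^ 2) μ)
    (hdet : (covMatrix μ).det ≠ 0) : 0 < (CFC.sqrt (covMatrix μ)).det := by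
  have hK := covMatrix_posSemidef hX
  have h := CFC.sqrt_mul_sqrt_self (covMatrix μ) hK.nonneg
  have h0 : 0 ≤ (CFC.sqrt (covMatrix μ)).det :=
    (Matrix.nonneg_iff_posSemidef.1 (CFC.sqrt_nonneg (covMatrix μ))).det_nonneg
  refine lt_of_le_of_ne h0 fun h1 => hdet ?_
  rw [← h, Matrix.det_mul, ← h1, zero_mul]

/-- Whitening a random vector by the square root of its covariance matrix, around any centre,
leaves second moments at least one. -/
lemma one_le_integral_whitened_sq (hX : ∀ i, Integrable (fun x => x i ^ 2) μ)
    (hdet : (covMatrix μ).det ≠ 0) (m : EuclideanSpace ℝ (Fin n)) (i : Fin n) :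
    Integrable (fun x => (toEuclideanCLM (𝕜 := ℝ) (CFC.sqrt (covMatrix μ))⁻¹ (x - m) i) ^ 2) μ ∧
      1 ≤ ∫ x, (toEuclideanCLM (𝕜 := ℝ) (CFC.sqrt (covMatrix μ))⁻¹ (x - m) i) ^ 2 ∂μ := by
  have hpos := sqrt_covMatrix_det_pos hX hdet
  have hK := covMatrix_posSemidef hX
  have hAA := CFC.sqrt_mul_sqrt_self (covMatrix μ) hK.nonneg
  have hsymm : (CFC.sqrt (covMatrix μ)).IsHermitian :=
    (Matrix.nonneg_iff_posSemidef.1 (CFC.sqrt_nonneg (covMatrix μ))).isHermitian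
  set A := CFC.sqrt (covMatrix μ)
  have hu : IsUnit A.det := hpos.ne'.isUnit
  have hform : ∀ x : EuclideanSpace ℝ (Fin n), toEuclideanCLM (𝕜 := ℝ) A⁻¹ (x - m) i =
      ∑ j, A⁻¹ i j * x j - ∑ j, A⁻¹ i j * m j := fun x => by
    rw [Matrix.ofLp_toEuclideanCLM, Matrix.mulVec, dotProduct, ← Finset.sum_sub_distrib]
    exact Finset.sum_congr rfl fun j _ => by simp [mul_sub]
  simp_rw [hform]
  have hL : MemLp (fun x : EuclideanSpace ℝ (Fin n) => ∑ j, A⁻¹ i j * x j) 2 μ :=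
    memLp_finsetSum _ fun j _ => (memLp_coord hX j).const_mul _
  have hL2 : MemLp (fun x : EuclideanSpace ℝ (Fin n) =>
      ∑ j, A⁻¹ i j * x j - ∑ j, A⁻¹ i j * m j) 2 μ := hL.sub (memLp_const _)
  refine ⟨hL2.integrable_sq, ?_⟩
  -- The variance is a diagonal entry of `A⁻¹ K A⁻ᵀ = 1`. The centre `m` does not affect it; the
  -- second moment about `m` can only be larger, which gives an inequality rather than an equality.
  have hvar : variance (fun x : EuclideanSpace ℝ (Fin n) =>
      ∑ j, A⁻¹ i j * x j - ∑ j, A⁻¹ i j * m j) μ = 1 := by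
    rw [variance_sub_const hL.aestronglyMeasurable, variance_linear hX]
    have h1 : A⁻¹ * covMatrix μ * (A⁻¹).transpose = 1 := by
      have ht : (A⁻¹).transpose = A⁻¹ := by
        rw [Matrix.transpose_nonsing_inv]
        congr 1
      rw [ht, ← hAA, ← mul_assoc, Matrix.nonsing_inv_mul _ hu, one_mul, Matrix.mul_nonsing_inv _ hu]
    have h2 := congrFun (congrFun h1 i) i
    rw [Matrix.one_apply_eq] at h2
    rw [← h2]
    simp only [Matrix.mul_apply, Matrix.transpose_apply, Finset.sum_mul]
    rw [Finset.sum_comm]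
    exact Finset.sum_congr rfl fun j _ => Finset.sum_congr rfl fun k _ => mul_right_comm _ _ _
  rw [← hvar]
  exact variance_le_expectation_sq hL2.aestronglyMeasurable

/-- The divergence from any Gaussian law with the same covariance dominates the entropy gap. -/
lemma diffEntropy_of_klDiv_ne_top (hX : ∀ i, Integrable (fun x => x i ^ 2) μ)
    (hdet : (covMatrix μ).det ≠ 0) (m : EuclideanSpace ℝ (Fin n))
    (hkl : klDiv μ (multivariateGaussian m (covMatrix μ)) ≠ ∞) :
    ∃ h : ℝ, diffEntropy μ = h ∧
      n * ((Real.log (2 * Real.pi) + 1) / 2) + Real.log (covMatrix μ).det / 2 - h ≤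
        (klDiv μ (multivariateGaussian m (covMatrix μ))).toReal := by
  have hpos := sqrt_covMatrix_det_pos hX hdet
  have hwhite := one_le_integral_whitened_sq hX hdet m
  have hγ := multivariateGaussian_eq_withDensity m hpos
  have : IsProbabilityMeasure (multivariateGaussian m (covMatrix μ)) := inferInstance
  have hdetlog : Real.log (covMatrix μ).det = 2 * Real.log (CFC.sqrt (covMatrix μ)).det := by
    rw [← CFC.sqrt_mul_sqrt_self (covMatrix μ) (covMatrix_posSemidef hX).nonneg, Matrix.det_mul,
      Real.log_mul hpos.ne' hpos.ne', CFC.sqrt_mul_sqrt_self _ (covMatrix_posSemidef hX).nonneg]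
    ring
  set γ := multivariateGaussian m (covMatrix μ)
  set A := CFC.sqrt (covMatrix μ)
  set g : EuclideanSpace ℝ (Fin n) → ℝ :=
    fun x => A.det⁻¹ * noisePDF 2 1 (toEuclideanCLM (𝕜 := ℝ) A⁻¹ (x - m)) with hg
  have hgm : Measurable g := by fun_prop
  have hg0 : ∀ x, 0 < g x := fun x => mul_pos (inv_pos.2 hpos) (noisePDF_pos two_pos one_pos _)
  obtain ⟨hac, hint⟩ := klDiv_ne_top_iff.1 hkl
  have : μ.HaveLebesgueDecomposition γ := Measure.haveLebesgueDecomposition_of_sigmaFinite μ γ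
  have hγac : γ ≪ volume := by rw [hγ]; exact withDensity_absolutelyContinuous _ _
  have hμac : μ ≪ volume := hac.trans hγac
  have hγrn : γ.rnDeriv volume =ᵐ[volume] fun x => ENNReal.ofReal (g x) := by
    rw [hγ]; exact Measure.rnDeriv_withDensity _ (by fun_prop)
  have hlogg : ∀ x, Real.log (g x) = -Real.log A.det - n * (Real.log (2 * Real.pi) / 2)
      - ∑ i, (toEuclideanCLM (𝕜 := ℝ) A⁻¹ (x - m) i) ^ 2 / 2 := fun x => by
    rw [hg, Real.log_mul (inv_pos.2 hpos).ne' (noisePDF_pos two_pos one_pos _).ne', Real.log_inv,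
      log_noisePDF two_pos one_pos, Finset.sum_sub_distrib, genNormalConst_two, mul_one,
      Real.log_sqrt (by positivity)]
    simp only [Real.rpow_two, sq_abs, Finset.sum_const, Finset.card_univ, Fintype.card_fin,
      nsmul_eq_mul, mul_one]
    rw [← Finset.mul_sum, ← Finset.sum_div]
    ring
  have hsumint : Integrable
      (fun x => ∑ i, (toEuclideanCLM (𝕜 := ℝ) A⁻¹ (x - m) i) ^ 2 / 2) μ :=
    integrable_finsetSum Finset.univ fun i _ => (hwhite i).1.div_const 2
  have hloggint : Integrable (fun x => Real.log (g x)) μ := by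
    simp_rw [hlogg]
    exact (integrable_const _).sub hsumint
  -- The whitened second moments are at least one each, so the quadratic part contributes at most
  -- `-n / 2`; equality would require `m` to be the mean.
  have hlogg_le : ∫ x, Real.log (g x) ∂μ ≤
      -Real.log A.det - n * (Real.log (2 * Real.pi) / 2) - n / 2 := by
    simp_rw [hlogg]
    rw [integral_sub (integrable_const _) hsumint,
      integral_finsetSum _ fun i _ => (hwhite i).1.div_const 2]
    simp_rw [integral_div]
    have : (n / 2 : ℝ) ≤ ∑ i, (∫ x, (toEuclideanCLM (𝕜 := ℝ) A⁻¹ (x - m) i) ^ 2 ∂μ) / 2 := by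
      calc (n / 2 : ℝ) = ∑ i : Fin n, (1 / 2 : ℝ) := by simp; ring
        _ ≤ _ := Finset.sum_le_sum fun i _ => by have := (hwhite i).2; gcongr
    simp only [integral_const, probReal_univ, one_smul]
    linarith
  -- Chain rule for densities, `dμ/dx = (dμ/dγ) g`; integrating its logarithm against `μ` splits
  -- `-h(X)` into the divergence and the expected Gaussian log-density.
  have hllr : llr μ volume =ᵐ[μ] fun x => llr μ γ x + Real.log (g x) := by
    filter_upwards [hμac.ae_le (Measure.rnDeriv_mul_rnDeriv (κ := volume) hac), hμac.ae_le hγrn,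
      Measure.rnDeriv_pos hac, hac.ae_le (Measure.rnDeriv_ne_top μ γ)] with x h1 h2 h3 h4
    rw [llr, llr, ← h1, Pi.mul_apply, h2, ENNReal.toReal_mul, ENNReal.toReal_ofReal (hg0 x).le,
      Real.log_mul (ENNReal.toReal_pos h3.ne' h4).ne' (hg0 x).ne']
  have hfint : Integrable (llr μ volume) μ := (integrable_congr hllr).2 (hint.add hloggint)
  have hfval : ∫ x, llr μ volume x ∂μ = ∫ x, llr μ γ x ∂μ + ∫ x, Real.log (g x) ∂μ := by
    rw [integral_congr_ae hllr, integral_add hint hloggint]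
  have hneg : ∀ x, Real.negMulLog (μ.rnDeriv volume x).toReal =
      -((μ.rnDeriv volume x).toReal • llr μ volume x) := fun x => by
    rw [Real.negMulLog, llr, smul_eq_mul, neg_mul]
  have hnint : Integrable (fun x => Real.negMulLog (μ.rnDeriv volume x).toReal) := by
    simp_rw [hneg]
    exact ((integrable_rnDeriv_smul_iff hμac).2 hfint).neg
  refine ⟨-∫ x, llr μ volume x ∂μ, ?_, ?_⟩
  -- Integrability makes both parts in `diffEntropy` finite, so the `EReal` difference is an
  -- ordinary one.
  · have hval : ∫ x, Real.negMulLog (μ.rnDeriv volume x).toReal = -∫ x, llr μ volume x ∂μ := by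
      simp_rw [hneg]
      rw [integral_neg, integral_rnDeriv_smul hμac]
    rw [diffEntropy, if_pos hμac, ← hval,
      integral_eq_lintegral_pos_part_sub_lintegral_neg_part hnint, EReal.coe_sub,
      EReal.coe_ennreal_toReal hnint.lintegral_lt_top.ne,
      EReal.coe_ennreal_toReal (Integrable.lintegral_lt_top hnint.fun_neg).ne]
  · rw [toReal_klDiv_of_measure_eq hac (by simp)]
    rw [hfval]
    linarith

end Covariance

end RateDistortion

/-! ### Constants, moment norms and comparison of distortions -/

namespace RateDistortion

variable {n : ℕ}

lemma alphaConst_pos {r : ℝ} (hr : 0 < r) : 0 < alphaConst r := by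
  have : 0 < Real.Gamma (1 + 1 / r) := Real.Gamma_pos_of_pos (by positivity)
  unfold alphaConst
  positivity

lemma one_le_betaConst {r : ℝ} (hr : 0 < r) : 1 ≤ betaConst r := by
  have h1 : 0 < Real.Gamma (3 / r) := Real.Gamma_pos_of_pos (by positivity)
  have h2 : 0 < Real.Gamma (1 / r) := Real.Gamma_pos_of_pos (by positivity)
  rw [betaConst, Real.one_le_sqrt]
  have : 0 < r ^ (2 / r) * Real.Gamma (3 / r) / Real.Gamma (1 / r) := by positivity
  linarith

/-- Both sides are the entropy of the generalized normal law: the log-normalizer plus the expected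
exponent `1 / r`. This is where `α_r` comes from. -/
lemma log_genNormalConst_add {r d : ℝ} (hr : 0 < r) (hd : 0 < d) :
    Real.log (genNormalConst r d) + 1 / r = Real.log (alphaConst r * d ^ (1 / r)) := by
  rw [← Real.log_exp (1 / r), ← Real.log_mul (genNormalConst_pos hr hd).ne' (Real.exp_pos _).ne',
    Real.log_exp, genNormalConst, alphaConst, Real.mul_rpow hr.le hd.le]
  congr 1
  ring

lemma log_genNormalConst_two_add {τ : ℝ} (hτ : 0 < τ) :
    Real.log (genNormalConst 2 τ) + 1 / 2 =
      (Real.log (2 * Real.pi) + 1) / 2 + Real.log τ / 2 := by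
  rw [genNormalConst_two, Real.log_sqrt (by positivity),
    Real.log_mul (by positivity) hτ.ne']
  ring

/-- The variance of the generalized normal law in terms of `β_r`. -/
lemma integral_sq_genNormal_eq_betaConst {r d : ℝ} (hr : 0 < r) (hd : 0 < d) :
    ∫ z, z ^ 2 ∂(genNormal r d) = d ^ (2 / r) * (betaConst r ^ 2 - 1) := by
  have h1 : 0 < Real.Gamma (3 / r) := Real.Gamma_pos_of_pos (by positivity)
  have h2 : 0 < Real.Gamma (1 / r) := Real.Gamma_pos_of_pos (by positivity)
  rw [integral_sq_genNormal hr hd, betaConst, Real.sq_sqrt (by positivity),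
    Real.mul_rpow hr.le hd.le]
  ring

section Moments

variable {μ : Measure (EuclideanSpace ℝ (Fin n))}

lemma momentNorm_rpow {p : ℝ} (hp : 0 < p) :
    momentNorm p μ ^ p = ∫⁻ x, ∑ i, ENNReal.ofReal (|x i| ^ p) ∂μ := by
  rw [momentNorm, ← ENNReal.rpow_mul, one_div_mul_cancel hp.ne', ENNReal.rpow_one]

lemma momentNorm_two_sq :
    momentNorm 2 μ ^ 2 = ∑ i, ∫⁻ x, ENNReal.ofReal (x i ^ 2) ∂μ := by
  have h := momentNorm_rpow (μ := μ) two_pos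
  rw [ENNReal.rpow_two] at h
  rw [h, lintegral_finsetSum _ fun i _ => by fun_prop]
  simp only [Real.rpow_two, sq_abs]

lemma integrable_sq_of_momentNorm_lt_top (h : momentNorm 2 μ < ∞) (i : Fin n) :
    Integrable (fun x => x i ^ 2) μ := by
  have h2 : ∑ i, ∫⁻ x, ENNReal.ofReal (x i ^ 2) ∂μ < ∞ := by
    rw [← momentNorm_two_sq]; exact ENNReal.pow_lt_top h
  have h3 := (ENNReal.sum_lt_top.1 h2) i (Finset.mem_univ i)
  have hm : Measurable fun x : EuclideanSpace ℝ (Fin n) => x i ^ 2 := by fun_prop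
  refine ⟨hm.aestronglyMeasurable, ?_⟩
  rwa [hasFiniteIntegral_iff_ofReal (.of_forall fun x => by positivity)]

lemma momentNorm_two_sq_eq_ofReal (h : momentNorm 2 μ < ∞) :
    momentNorm 2 μ ^ 2 = ENNReal.ofReal (∑ i, ∫ x, x i ^ 2 ∂μ) := by
  rw [momentNorm_two_sq, ENNReal.ofReal_sum_of_nonneg
    fun i _ => integral_nonneg fun x => by positivity]
  exact Finset.sum_congr rfl fun i _ => (ofReal_integral_eq_lintegral_ofReal
    (integrable_sq_of_momentNorm_lt_top h i) (.of_forall fun x => by positivity)).symm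

lemma ofReal_threshold_sq (n : ℕ) {d : ℝ} (hd : 0 ≤ d) (r : ℝ) :
    ENNReal.ofReal (√n * d ^ (1 / r)) ^ 2 = ENNReal.ofReal (n * d ^ (2 / r)) := by
  rw [← ENNReal.ofReal_pow (by positivity), mul_pow, Real.sq_sqrt (by positivity),
    ← Real.rpow_natCast, ← Real.rpow_mul hd]
  congr 3
  push_cast
  ring

lemma threshold_lt_iff {d : ℝ} (hd : 0 ≤ d) (r : ℝ) (h : momentNorm 2 μ < ∞) :
    ENNReal.ofReal (√n * d ^ (1 / r)) < momentNorm 2 μ ↔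
      n * d ^ (2 / r) < ∑ i, ∫ x, x i ^ 2 ∂μ := by
  rw [← ENNReal.pow_lt_pow_left_iff two_ne_zero, ofReal_threshold_sq n hd r,
    momentNorm_two_sq_eq_ofReal h, ENNReal.ofReal_lt_ofReal_iff_of_nonneg (by positivity)]

/-- Positivity of the second moment matters: `0 / 0 = 0` in `ℝ≥0∞`, and its logarithm would be `⊥`.
-/
lemma normCovTerm_of_det_eq_zero (hn : 1 ≤ n) (h : momentNorm 2 μ < ∞)
    (hS : 0 < ∑ i, ∫ x, x i ^ 2 ∂μ) (hdet : (covMatrix μ).det = 0) : normCovTerm μ = ⊤ := by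
  have hn0 : (0 : ℝ) < n := by exact_mod_cast hn
  rw [normCovTerm, hdet, Real.zero_rpow (by positivity), ENNReal.ofReal_zero,
    momentNorm_two_sq_eq_ofReal h, ENNReal.div_zero, ENNReal.log_top,
    EReal.coe_mul_top_of_pos (by positivity)]
  exact (ENNReal.div_pos (ENNReal.ofReal_pos.2 hS).ne' (by simp)).ne'

lemma normCovTerm_of_det_pos (hn : 1 ≤ n) (h : momentNorm 2 μ < ∞)
    (hS : 0 < ∑ i, ∫ x, x i ^ 2 ∂μ) (hdet : 0 < (covMatrix μ).det) :
    normCovTerm μ = ((n / 2 * Real.log ((∑ i, ∫ x, x i ^ 2 ∂μ) / n) -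
      Real.log (covMatrix μ).det / 2 : ℝ) : EReal) := by
  have hn0 : (0 : ℝ) < n := by exact_mod_cast hn
  rw [normCovTerm, momentNorm_two_sq_eq_ofReal h, ← ENNReal.ofReal_natCast n,
    ← ENNReal.ofReal_div_of_pos hn0, ← ENNReal.ofReal_div_of_pos (by positivity),
    ENNReal.log_ofReal_of_pos (by positivity), ← EReal.coe_mul,
    Real.log_div (by positivity) (by positivity), Real.log_rpow hdet]
  congr 1
  field_simp

lemma rateDistortion_le {κ : Kernel (EuclideanSpace ℝ (Fin n)) (EuclideanSpace ℝ (Fin n))}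
    [IsMarkovKernel κ] {r d : ℝ}
    (h : distortion r μ κ ≤ ENNReal.ofReal d) : rateDistortion r μ d ≤ mutualInfo μ κ :=
  iInf_le_of_le κ (iInf_le_of_le inferInstance (iInf_le_of_le h le_rfl))

lemma distortion_const_dirac_zero (r : ℝ) :
    distortion r μ (Kernel.const _ (Measure.dirac 0)) =
      (∫⁻ x, ∑ i, ENNReal.ofReal (|x i| ^ r) ∂μ) / n := by
  simp [distortion, lintegral_dirac]

end Moments

section Distortion

variable {μ : Measure (EuclideanSpace ℝ (Fin n))} [IsProbabilityMeasure μ]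
  {κ : Kernel (EuclideanSpace ℝ (Fin n)) (EuclideanSpace ℝ (Fin n))} [IsMarkovKernel κ]

/-- Young's inequality comparing the `r`-th power with the square at scale `d^{1/r}`. -/
lemma abs_rpow_le_of_le_two {r d : ℝ} (hr : 0 < r) (hr2 : r ≤ 2) (hd : 0 < d) (u : ℝ) :
    |u| ^ r ≤ r / 2 * (d / d ^ (2 / r)) * |u| ^ (2 : ℝ) + (1 - r / 2) * d := by
  set D := d ^ (2 / r)
  have hD : 0 < D := by positivity
  have hDr : D ^ (r / 2) = d := by
    rw [← Real.rpow_mul hd.le, show 2 / r * (r / 2) = 1 by field_simp, Real.rpow_one]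
  -- Weighted AM–GM between `|u|²` and `D`, with equality at `|u|² = D`, that is at `|u|^r = d`.
  have h := Real.geom_mean_le_arith_mean2_weighted (w₁ := r / 2) (w₂ := 1 - r / 2)
    (p₁ := |u| ^ (2 : ℝ)) (p₂ := D) (by positivity) (by linarith) (by positivity) hD.le (by ring)
  rw [← Real.rpow_mul (abs_nonneg u), show 2 * (r / 2) = r by ring, Real.rpow_sub hD,
    Real.rpow_one, hDr] at h
  calc |u| ^ r = (|u| ^ r * (D / d)) * (d / D) := by field_simp
    _ ≤ (r / 2 * |u| ^ (2 : ℝ) + (1 - r / 2) * D) * (d / D) := by gcongr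
    _ = _ := by field_simp

/-- Averaging the affine bound in `|u|²` replaces Jensen; at mean square `d^{2/r}` that bound equals
`d`. -/
lemma distortion_le_of_distortion_two_le_of_pos (hn : 1 ≤ n) {r d : ℝ} (hr : 0 < r)
    (hr2 : r ≤ 2) (hd : 0 < d) (h : distortion 2 μ κ ≤ ENNReal.ofReal (d ^ (2 / r))) :
    distortion r μ κ ≤ ENNReal.ofReal d := by
  have hn0 : (n : ℝ≥0∞) ≠ 0 := by exact_mod_cast (by omega : n ≠ 0)
  set c := ENNReal.ofReal (r / 2 * (d / d ^ (2 / r))) with hc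
  set e := ENNReal.ofReal ((1 - r / 2) * d) with he
  have hpt : ∀ x y : EuclideanSpace ℝ (Fin n), ∑ i, ENNReal.ofReal (|x i - y i| ^ r) ≤
      c * ∑ i, ENNReal.ofReal (|x i - y i| ^ (2 : ℝ)) + n * e := fun x y => by
    rw [Finset.mul_sum, show (n : ℝ≥0∞) * e = ∑ _i : Fin n, e by simp, ← Finset.sum_add_distrib]
    refine Finset.sum_le_sum fun i _ => ?_
    rw [hc, he, ← ENNReal.ofReal_mul (by positivity), ← ENNReal.ofReal_add (by positivity)
      (mul_nonneg (by linarith) hd.le)]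
    exact ENNReal.ofReal_le_ofReal (abs_rpow_le_of_le_two hr hr2 hd _)
  have hint : ∫⁻ x, ∫⁻ y, ∑ i, ENNReal.ofReal (|x i - y i| ^ r) ∂(κ x) ∂μ ≤
      c * (∫⁻ x, ∫⁻ y, ∑ i, ENNReal.ofReal (|x i - y i| ^ (2 : ℝ)) ∂(κ x) ∂μ) + n * e := by
    calc _ ≤ ∫⁻ x, ∫⁻ y, (c * ∑ i, ENNReal.ofReal (|x i - y i| ^ (2 : ℝ)) + n * e) ∂(κ x) ∂μ :=
          lintegral_mono fun x => lintegral_mono fun y => hpt x y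
      _ = _ := by
          simp_rw [lintegral_add_right _ measurable_const,
            lintegral_const_mul' c _ ENNReal.ofReal_ne_top]
          simp only [lintegral_const, measure_univ, mul_one]
          rw [lintegral_add_right _ measurable_const, lintegral_const_mul' c _ ENNReal.ofReal_ne_top]
          simp only [lintegral_const, measure_univ, mul_one]
  rw [distortion] at h ⊢
  calc _ ≤ (c * (∫⁻ x, ∫⁻ y, ∑ i, ENNReal.ofReal (|x i - y i| ^ (2 : ℝ)) ∂(κ x) ∂μ) + n * e) / n := by
        gcongr
    _ = c * ((∫⁻ x, ∫⁻ y, ∑ i, ENNReal.ofReal (|x i - y i| ^ (2 : ℝ)) ∂(κ x) ∂μ) / n) + e := by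
        rw [ENNReal.add_div, mul_comm (n : ℝ≥0∞) e,
          ENNReal.mul_div_cancel_right hn0 (ENNReal.natCast_ne_top n), mul_div_assoc]
    _ ≤ c * ENNReal.ofReal (d ^ (2 / r)) + e := by gcongr
    _ = ENNReal.ofReal d := by
        rw [hc, he, ← ENNReal.ofReal_mul (by positivity), ← ENNReal.ofReal_add (by positivity)
          (mul_nonneg (by linarith) hd.le)]
        congr 1
        have : 0 < d ^ (2 / r) := by positivity
        field_simp
        ring

/-- Jensen's inequality for distortions of order `r ≤ 2`. -/
lemma distortion_le_of_distortion_two_le (hn : 1 ≤ n) {r d : ℝ} (hr : 0 < r)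
    (hr2 : r ≤ 2) (hd : 0 ≤ d) (h : distortion 2 μ κ ≤ ENNReal.ofReal (d ^ (2 / r))) :
    distortion r μ κ ≤ ENNReal.ofReal d := by
  -- The coefficients above need a positive level, so `d = 0` is reached through `d + ε`.
  refine ENNReal.le_of_forall_pos_le_add fun ε hε _ => ?_
  have hε' : (0 : ℝ) < ε := hε
  rw [← ENNReal.ofReal_coe_nnreal, ← ENNReal.ofReal_add hd hε'.le]
  refine distortion_le_of_distortion_two_le_of_pos hn hr hr2 (by linarith) (h.trans ?_)
  refine ENNReal.ofReal_le_ofReal (Real.rpow_le_rpow hd (by linarith) (by positivity))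

lemma mutualInfo_const (ν : Measure (EuclideanSpace ℝ (Fin n))) [IsProbabilityMeasure ν] :
    mutualInfo μ (Kernel.const _ ν) = 0 := by
  rw [mutualInfo, Measure.compProd_const, Measure.const_comp]
  simp

end Distortion

end RateDistortion

/-! ### Rate bounds and the gap to the Shannon lower bound -/

namespace RateDistortion

variable {n : ℕ} {μ : Measure (EuclideanSpace ℝ (Fin n))} [IsProbabilityMeasure μ]

/-- The rate-distortion function for distortion orders at most two, from the Gaussian forward
channel. -/
lemma rateDistortion_le_of_le_two (hn : 1 ≤ n) {r d : ℝ} (hr : 0 < r) (hr2 : r ≤ 2) (hd : 0 < d)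
    (h : momentNorm 2 μ < ∞) (hS : n * d ^ (2 / r) < ∑ i, ∫ x, x i ^ 2 ∂μ) :
    (rateDistortion r μ d : EReal) ≤
      ((n * (Real.log ((∑ i, ∫ x, x i ^ 2 ∂μ) / n) / 2 - Real.log d / r) : ℝ) : EReal) := by
  have hn0 : (0 : ℝ) < n := by exact_mod_cast hn
  have hX := integrable_sq_of_momentNorm_lt_top h
  set S := ∑ i, ∫ x, x i ^ 2 ∂μ with hSdef
  set D := d ^ (2 / r) with hDdef
  have hD : 0 < D := by positivity
  have hDT : D < S / n := by rw [lt_div_iff₀ hn0]; linarith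
  obtain ⟨T, hT⟩ : ∃ T, T = S / n := ⟨_, rfl⟩
  rw [← hT] at hDT ⊢
  have hT0 : 0 < T := hD.trans hDT
  -- With noise variance `a D`, the error is `(1 - a)² T + a D = D` and the output second moment per
  -- coordinate is `a² T + a D = a T`. The factor `a` cancels in the ratio `a T / (a D)`.
  obtain ⟨a, ha⟩ : ∃ a, a = 1 - D / T := ⟨_, rfl⟩
  have haT : a * T = T - D := by rw [ha]; field_simp
  have ha0 : 0 < a := by rw [ha, sub_pos, div_lt_one hT0]; exact hDT
  have hδ : 0 < a * D := by positivity
  have hv : ∫ z, z ^ 2 ∂(genNormal 2 (a * D)) = a * D := by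
    have := integral_rpow_genNormal two_pos hδ
    simpa only [Real.rpow_two, sq_abs] using this
  have := isMarkovKernel_noiseChannel (n := n) (a := a) two_pos hδ
  have hdist : distortion r μ (noiseChannel n 2 (a * D) a) ≤ ENNReal.ofReal d := by
    refine distortion_le_of_distortion_two_le hn hr hr2 hd.le ?_
    rw [distortion_two_noiseChannel hn two_pos hδ μ hX, hv, ← hSdef, ← hT]
    refine le_of_eq (congrArg _ ?_)
    rw [ha]
    field_simp
    ring
  have hmi := mutualInfo_noiseChannel_le (a := a) (τ := a * T) hn two_pos hδ hX (by positivity)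
    (by
      have hST : S = n * T := by rw [hT]; field_simp
      rw [hv, ← hSdef, hST]
      linear_combination n * a * haT)
  refine (EReal.coe_ennreal_le_coe_ennreal_iff.2 (rateDistortion_le hdist)).trans (hmi.trans_eq ?_)
  rw [log_genNormalConst_two_add (by positivity), log_genNormalConst_two_add hδ,
    Real.log_mul ha0.ne' hT0.ne', Real.log_mul ha0.ne' hD.ne', hDdef, Real.log_rpow hd]
  congr 1
  ring

/-- The rate-distortion function for general distortion orders, from the additive channel with
generalized normal noise. -/
lemma rateDistortion_le_of_second_moment_le (hn : 1 ≤ n) {r d M : ℝ} (hr : 0 < r) (hd : 0 < d)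
    (h : momentNorm 2 μ < ∞) (hSM : ∑ i, ∫ x, x i ^ 2 ∂μ ≤ n * M) (hdM : d ^ (2 / r) ≤ M) :
    (rateDistortion r μ d : EReal) ≤
      ((n * ((Real.log (2 * Real.pi) + 1) / 2 + Real.log (betaConst r) + Real.log M / 2 -
        Real.log (alphaConst r * d ^ (1 / r))) : ℝ) : EReal) := by
  have hn0 : (0 : ℝ) < n := by exact_mod_cast hn
  have hX := integrable_sq_of_momentNorm_lt_top h
  have hD : 0 < d ^ (2 / r) := by positivity
  have hM : 0 < M := hD.trans_le hdM
  have hβ := one_le_betaConst hr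
  have hv := integral_sq_genNormal_eq_betaConst hr hd
  have hv0 : 0 < ∫ z, z ^ 2 ∂(genNormal r d) := by
    have h1 : 0 < Real.Gamma (3 / r) := Real.Gamma_pos_of_pos (by positivity)
    have h2 : 0 < Real.Gamma (1 / r) := Real.Gamma_pos_of_pos (by positivity)
    rw [integral_sq_genNormal hr hd]
    positivity
  have hS0 : 0 ≤ ∑ i, ∫ x, x i ^ 2 ∂μ :=
    Finset.sum_nonneg fun i _ => integral_nonneg fun x => by positivity
  set S := ∑ i, ∫ x, x i ^ 2 ∂μ with hSdef
  set τ := S / n + ∫ z, z ^ 2 ∂(genNormal r d) with hτdef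
  have hτ : 0 < τ := by positivity
  -- `M` dominates both the signal power and `d^{2/r}`, so `τ ≤ M + M (β² - 1)`.
  have hτM : τ ≤ betaConst r ^ 2 * M := by
    have h1 : S / n ≤ M := by rw [div_le_iff₀ hn0]; linarith
    have h2 : d ^ (2 / r) * (betaConst r ^ 2 - 1) ≤ M * (betaConst r ^ 2 - 1) :=
      mul_le_mul_of_nonneg_right hdM (by nlinarith)
    rw [hτdef, hv]
    linarith
  have hlog : Real.log τ ≤ 2 * Real.log (betaConst r) + Real.log M := by
    refine (Real.log_le_log hτ hτM).trans_eq ?_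
    rw [Real.log_mul (by positivity) hM.ne', Real.log_pow]
    norm_num
  have := isMarkovKernel_noiseChannel (n := n) (a := 1) hr hd
  have hmi := mutualInfo_noiseChannel_le (a := 1) (τ := τ) hn hr hd hX hτ
    (by rw [← hSdef, hτdef]; field_simp)
  refine (EReal.coe_ennreal_le_coe_ennreal_iff.2
    (rateDistortion_le (distortion_noiseChannel_one hn hr hd μ).le)).trans (hmi.trans ?_)
  rw [EReal.coe_le_coe_iff, log_genNormalConst_two_add hτ, log_genNormalConst_add hr hd]
  refine mul_le_mul_of_nonneg_left ?_ hn0.le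
  linarith

lemma rateDistortion_eq_zero_of_distortion_le {r d : ℝ}
    (h : distortion r μ (Kernel.const _ (Measure.dirac 0)) ≤ ENNReal.ofReal d) :
    rateDistortion r μ d = 0 :=
  le_antisymm ((rateDistortion_le h).trans_eq (mutualInfo_const _)) zero_le

/-- A Gaussian-entropy upper bound on the rate turns into a bound on the gap to the Shannon lower
bound. -/
lemma rateDistortion_sub_shannonLowerBound_le (hn : 1 ≤ n) {r d ρ c : ℝ}
    (h : momentNorm 2 μ < ∞) (hS : 0 < ∑ i, ∫ x, x i ^ 2 ∂μ)
    (hrate : (rateDistortion r μ d : EReal) ≤ (ρ : EReal))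
    (hρ : ρ + n * Real.log (alphaConst r * d ^ (1 / r)) ≤
      n * ((Real.log (2 * Real.pi) + 1) / 2) + n / 2 * Real.log ((∑ i, ∫ x, x i ^ 2 ∂μ) / n) + c)
    (m : EuclideanSpace ℝ (Fin n)) :
    (rateDistortion r μ d : EReal) - shannonLowerBound r μ d ≤
      (klDiv μ (multivariateGaussian m (covMatrix μ)) : EReal) + (c : EReal) + normCovTerm μ := by
  have hX := integrable_sq_of_momentNorm_lt_top h
  -- In `EReal`, `⊥ + ⊤ = ⊥`, so the infinite covariance term is decisive only if the rest is not
  -- `⊥`.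
  have hkl0 : (klDiv μ (multivariateGaussian m (covMatrix μ)) : EReal) + (c : EReal) ≠ ⊥ := by
    simp [EReal.add_eq_bot_iff]
  by_cases hdet : (covMatrix μ).det = 0
  · rw [normCovTerm_of_det_eq_zero hn h hS hdet, EReal.add_top_of_ne_bot hkl0]
    exact le_top
  have hdet0 : 0 < (covMatrix μ).det :=
    lt_of_le_of_ne (covMatrix_posSemidef hX).det_nonneg (Ne.symm hdet)
  rw [normCovTerm_of_det_pos hn h hS hdet0]
  by_cases hkl : klDiv μ (multivariateGaussian m (covMatrix μ)) = ∞
  · rw [hkl, EReal.coe_ennreal_top, EReal.top_add_coe, EReal.top_add_coe]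
    exact le_top
  obtain ⟨H, hH, hle⟩ := diffEntropy_of_klDiv_ne_top hX hdet m hkl
  rw [shannonLowerBound, hH, ← EReal.coe_ennreal_toReal hkl, ← EReal.coe_sub, ← EReal.coe_add,
    ← EReal.coe_add]
  refine (EReal.sub_le_sub hrate le_rfl).trans ?_
  rw [← EReal.coe_sub, EReal.coe_le_coe_iff]
  linarith

end RateDistortion

theorem theorem10 {Ω : Type*} [MeasurableSpace Ω] (P : Measure Ω) [IsProbabilityMeasure P]
    {n : ℕ} (hn : 1 ≤ n) (X : Ω → EuclideanSpace ℝ (Fin n)) (hX : AEMeasurable X P)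
    (d r : ℝ) (hd : 0 ≤ d) (hr : 1 ≤ r) :
    (r ≤ 2 →
      (0 < d → RateDistortion.momentNorm 2 (P.map X) < ∞ →
        ENNReal.ofReal (√n * d ^ (1 / r)) < RateDistortion.momentNorm 2 (P.map X) →
        ∀ m : EuclideanSpace ℝ (Fin n),
          (RateDistortion.rateDistortion r (P.map X) d : EReal) -
              RateDistortion.shannonLowerBound r (P.map X) d ≤
            (klDiv (P.map X)
                (multivariateGaussian m (RateDistortion.covMatrix (P.map X))) : EReal) +
              ((n * Real.log (RateDistortion.alphaConst r / √(2 * Real.pi * Real.exp 1)) : ℝ) :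
                EReal) +
              RateDistortion.normCovTerm (P.map X)) ∧
      (RateDistortion.momentNorm 2 (P.map X) ≤ ENNReal.ofReal (√n * d ^ (1 / r)) →
        RateDistortion.rateDistortion r (P.map X) d = 0)) ∧
    (2 < r →
      (0 < d → RateDistortion.momentNorm 2 (P.map X) < ∞ →
        ENNReal.ofReal (√n * d ^ (1 / r)) ≤ RateDistortion.momentNorm 2 (P.map X) →
        ∀ m : EuclideanSpace ℝ (Fin n),
          (RateDistortion.rateDistortion r (P.map X) d : EReal) -
              RateDistortion.shannonLowerBound r (P.map X) d ≤
            (klDiv (P.map X)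
                (multivariateGaussian m (RateDistortion.covMatrix (P.map X))) : EReal) +
              ((n * Real.log (RateDistortion.betaConst r) : ℝ) : EReal) +
              RateDistortion.normCovTerm (P.map X)) ∧
      (RateDistortion.momentNorm r (P.map X) ≤ ENNReal.ofReal ((n * d) ^ (1 / r)) →
        RateDistortion.rateDistortion r (P.map X) d = 0) ∧
      (ENNReal.ofReal ((n * d) ^ (1 / r)) < RateDistortion.momentNorm r (P.map X) →
        RateDistortion.momentNorm 2 (P.map X) < ENNReal.ofReal (√n * d ^ (1 / r)) →
        (RateDistortion.rateDistortion r (P.map X) d : EReal) ≤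
          ((n * Real.log (√(2 * Real.pi * Real.exp 1) * RateDistortion.betaConst r /
            RateDistortion.alphaConst r) : ℝ) : EReal))) := by
  have hn0 : (0 : ℝ) < n := by exact_mod_cast hn
  have hr0 : 0 < r := by linarith
  have hα := RateDistortion.alphaConst_pos hr0
  have hβ := RateDistortion.one_le_betaConst hr0
  have : IsProbabilityMeasure (P.map X) := Measure.isProbabilityMeasure_map hX
  -- Only the law of `X` enters from here on.
  generalize P.map X = μ at *
  have hlogα (hd0 : 0 < d) : Real.log (RateDistortion.alphaConst r * d ^ (1 / r)) =
      Real.log (RateDistortion.alphaConst r) + Real.log d / r := by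
    rw [Real.log_mul hα.ne' (by positivity), Real.log_rpow hd0]
    ring
  have hloge : Real.log √(2 * Real.pi * Real.exp 1) = (Real.log (2 * Real.pi) + 1) / 2 := by
    rw [Real.log_sqrt (by positivity), Real.log_mul (by positivity) (Real.exp_pos _).ne',
      Real.log_exp]
  refine ⟨fun hr2 => ⟨fun hd0 h hlt m => ?_, fun hle => ?_⟩,
    fun hr2 => ⟨fun hd0 h hle m => ?_, fun hle => ?_, fun _ hlt => ?_⟩⟩
  · rw [RateDistortion.threshold_lt_iff hd r h] at hlt
    have hS : 0 < ∑ i, ∫ x, x i ^ 2 ∂μ := lt_of_le_of_lt (by positivity) hlt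
    refine RateDistortion.rateDistortion_sub_shannonLowerBound_le hn h hS
      (RateDistortion.rateDistortion_le_of_le_two hn hr0 hr2 hd0 h hlt) (le_of_eq ?_) m
    rw [hlogα hd0, Real.log_div hα.ne' (by positivity), hloge]
    ring
  · refine RateDistortion.rateDistortion_eq_zero_of_distortion_le
      (RateDistortion.distortion_le_of_distortion_two_le hn hr0 hr2 hd ?_)
    rw [RateDistortion.distortion_const_dirac_zero, ← RateDistortion.momentNorm_rpow two_pos,
      ENNReal.rpow_two]
    refine ENNReal.div_le_of_le_mul ((pow_le_pow_left₀ zero_le hle 2).trans_eq ?_)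
    rw [RateDistortion.ofReal_threshold_sq n hd r, mul_comm,
      ENNReal.ofReal_mul (by positivity), ENNReal.ofReal_natCast]
  · have hle' : n * d ^ (2 / r) ≤ ∑ i, ∫ x, x i ^ 2 ∂μ := by
      rw [← ENNReal.pow_le_pow_left_iff two_ne_zero, RateDistortion.ofReal_threshold_sq n hd r,
        RateDistortion.momentNorm_two_sq_eq_ofReal h] at hle
      refine (ENNReal.ofReal_le_ofReal_iff ?_).1 hle
      exact Finset.sum_nonneg fun i _ => integral_nonneg fun x => by positivity
    have hS : 0 < ∑ i, ∫ x, x i ^ 2 ∂μ := lt_of_lt_of_le (by positivity) hle'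
    -- Here the signal power is at least `d^{2/r}`, so `M` is the signal power itself.
    refine RateDistortion.rateDistortion_sub_shannonLowerBound_le hn h hS
      (RateDistortion.rateDistortion_le_of_second_moment_le (M := (∑ i, ∫ x, x i ^ 2 ∂μ) / n)
        hn hr0 hd0 h ?_ ?_) (le_of_eq ?_) m
    · field_simp
      exact le_rfl
    · rw [le_div_iff₀ hn0]
      linarith
    · ring
  · refine RateDistortion.rateDistortion_eq_zero_of_distortion_le ?_
    rw [RateDistortion.distortion_const_dirac_zero, ← RateDistortion.momentNorm_rpow hr0]
    refine ENNReal.div_le_of_le_mul ((ENNReal.rpow_le_rpow hle hr0.le).trans_eq ?_)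
    rw [ENNReal.ofReal_rpow_of_nonneg (by positivity) hr0.le, ← Real.rpow_mul (by positivity),
      one_div_mul_cancel hr0.ne', Real.rpow_one, mul_comm (n : ℝ), ENNReal.ofReal_mul hd,
      ENNReal.ofReal_natCast]
  -- At `d = 0` the threshold is zero and no norm lies strictly below it.
  · have hd0 : 0 < d := by
      refine lt_of_le_of_ne hd fun h0 => ?_
      rw [← h0, Real.zero_rpow (by positivity)] at hlt
      simp at hlt
    have h : RateDistortion.momentNorm 2 μ < ∞ := hlt.trans ENNReal.ofReal_lt_top
    have hlt' : ∑ i, ∫ x, x i ^ 2 ∂μ ≤ n * d ^ (2 / r) := by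
      by_contra hcon
      exact hlt.not_gt ((RateDistortion.threshold_lt_iff hd r h).2 (not_le.1 hcon))
    -- Now `d^{2/r}` is the larger quantity; with `M = d^{2/r}` the dependence on `d` cancels.
    refine (RateDistortion.rateDistortion_le_of_second_moment_le hn hr0 hd0 h hlt' le_rfl).trans_eq
      (congrArg _ ?_)
    rw [hlogα hd0, Real.log_div (by positivity) hα.ne',
      Real.log_mul (by positivity : √(2 * Real.pi * Real.exp 1) ≠ 0) (by positivity), hloge,
      Real.log_rpow hd0]
    ring
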